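/- **Corollary 3.3 (Struve and Anger–Weber derivatives).** *Branches.* Let $U\subseteq\mathbb{C}$ be open and let $\log$ be any continuous branch of the logarithm on $U$ (so $0\notin U$), for instance the principal branch on $U=\mathbb{C}\setminus(-\infty,0]$. For $z\in U$ put $z^{a}=e^{a\log z}$ and $(\tfrac12 z)^{a}=(\tfrac12)^{a}z^{a}$, where $(\tfrac12)^a=e^{-a\ln 2}$. All derivatives are with respect to $z\in U$, $h^{(m)}$ denotes the $m$-th derivative, $\mathbb{N}=\{0,1,2,\dots\}$, and an empty sum is $0$ and an empty product is $1$. *Functions.* For $\nu\in\mathbb{C}$ let $$\mathbf{H}_\nu(z)=(\tfrac12 z)^{\nu+1}\sum_{k=0}^\infty\frac{(-1)^k(\frac12 z)^{2k}}{\Gamma(k+\frac32)\Gamma(k+\nu+\frac32)},\qquad \mathbf{L}_\nu(z)=(\tfrac12 z)^{\nu+1}\sum_{k=0}^\infty\frac{(\frac12 z)^{2k}}{\Gamma(k+\frac32)\Gamma(k+\nu+\frac32)},$$ $$\mathbf{J}_\nu(z)=\frac1\pi\int_0^\pi\cos(\nu\theta-z\sin\theta)\,d\theta,\qquad \mathbf{E}_\nu(z)=\frac1\pi\int_0^\pi\sin(\nu\theta-z\sin\theta)\,d\theta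 ,$$ where $1/\Gamma$ is the entire reciprocal Gamma function. *Coefficients.* For $n\in\mathbb{N}$ and $0\le k\le n$ let $$A_k^n(\nu)=\frac{(2n)!\,(\nu+2k)\prod_{j=0}^{k-1}(2\nu+2j+1)}{2^{2n-k}(2k)!(n-k)!\prod_{j=0}^n(\nu+k+j)},\qquad B_k^n(\nu)=\frac{(2n+1)!\,(\nu+2k+1)\prod_{j=0}^{k-1}(2\nu+2j+1)}{2^{2n-k}(2k+1)!(n-k)!\prod_{j=0}^n(\nu+k+j+1)},$$ the factor $\nu+2k$ (respectively $\nu+2k+1$) being cancelled against the factor $j=k$ of the denominator. *Formulas.* Write $[N]=\{1,\dots,N\}$ and $-[N]=\{-1,\dots,-N\}$, both empty for $N\le 0$. Given functions $P_{\nu,l}^m(z)$, $Q_{\nu,l}^m(z)$ ($l,m\in\mathbb{N}$) and a sign $\sigma\in\{1,-1\}$, we say that $h$ satisfies the formulas $\Phi_\sigma(P,Q)$ if for every $\nu\in\mathbb{C}$ the functions $z^{-\nu}h_\nu(z)$ and $z^{\nu}h_\nu(z)$ are holomorphic on $U$ and, for all $n\in\mathbb{N}$ and $z\in U$, $$\begin{aligned}\frac{d^{2n}}{dz^{2n}}\Big(\frac{h_\nu(z)}{z^\nu}\Big)&=\sum_{k=0}^n\sigma^{n+k}A_k^n(\nu)\frac{h_{\nu+2k}(z)}{z^\nu}+\sum_{j=0}^{n-1}\sum_{k=0}^j\sigma^{k+j}A_k^j(\nu)P_{\nu,2k}^{2n-2j-1}(z)\\&\quad+\sum_{j=0}^{n-1}\sum_{k=0}^j\sigma^{k+j+1}B_k^j(\nu)P_{\nu,2k+1}^{2n-2j-2}(z),\qquad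 \nu\notin-[2n-1],\\ \frac{d^{2n+1}}{dz^{2n+1}}\Big(\frac{h_\nu(z)}{z^\nu}\Big)&=\sum_{k=0}^n\sigma^{n+k+1}B_k^n(\nu)\frac{h_{\nu+2k+1}(z)}{z^\nu}+\sum_{j=0}^{n}\sum_{k=0}^j\sigma^{k+j}A_k^j(\nu)P_{\nu,2k}^{2n-2j}(z)\\&\quad+\sum_{j=0}^{n-1}\sum_{k=0}^j\sigma^{k+j+1}B_k^j(\nu)P_{\nu,2k+1}^{2n-2j-1}(z),\qquad \nu\notin-[2n],\\ \frac{d^{2n}}{dz^{2n}}\big(z^\nu h_\nu(z)\big)&=\sum_{k=0}^n\sigma^{n+k}A_k^n(-\nu)z^\nu h_{\nu-2k}(z)+\sum_{j=0}^{n-1}\sum_{k=0}^j\sigma^{k+j}A_k^j(-\nu)Q_{\nu,2k}^{2n-2j-1}(z)\\&\quad+\sum_{j=0}^{n-1}\sum_{k=0}^j\sigma^{k+j}B_k^j(-\nu)Q_{\nu,2k+1}^{2n-2j-2}(z),\qquad \nu\notin[2n-1],\\ \frac{d^{2n+1}}{dz^{2n+1}}\big(z^\nu h_\nu(z)\big)&=\sum_{k=0}^n\sigma^{n+k}B_k^n(-\nu)z^\nu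 h_{\nu-2k-1}(z)+\sum_{j=0}^{n}\sum_{k=0}^j\sigma^{k+j}A_k^j(-\nu)Q_{\nu,2k}^{2n-2j}(z)\\&\quad+\sum_{j=0}^{n-1}\sum_{k=0}^j\sigma^{k+j}B_k^j(-\nu)Q_{\nu,2k+1}^{2n-2j-1}(z),\qquad \nu\notin[2n].\end{aligned}$$ The $F$-type formulas are those with $\sigma=1$, the $G$-type formulas those with $\sigma=-1$. *Explicit terms.* Let $\langle x\rangle_m=x(x-1)\cdots(x-m+1)$ be the falling factorial and $\delta$ the Kronecker delta. For $m\in\mathbb{N}$ let $$t_{\nu,l}^m(z)=\frac{(2\nu+l)(\frac12)^{\nu+l+1}}{\sqrt\pi(\nu+l)\Gamma(\nu+l+\frac32)}\langle l\rangle_m z^{l-m}\ (l\ge1),\qquad t_{\nu,0}^m(z)=\frac{(\frac12)^\nu}{\sqrt\pi\,\Gamma(\nu+\frac32)}\delta_{0,m},$$ $$u_{\nu,l}^m(z)=\frac{l(\frac12)^{\nu-l+1}}{\sqrt\pi(l-\nu)\Gamma(\nu-l+\frac32)}\langle2\nu-l\rangle_m z^{2\nu-l-m}\ (l\ge1),\qquad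 u_{\nu,0}^m(z)=0,$$ and, for a function $c$ on $\mathbb{C}$, $$v_{\nu,l}^m(z)=-\frac{\nu}{\pi(\nu+l)}c(\nu+l)\langle-\nu-1\rangle_m z^{-\nu-m-1}\ (l\ge1),\qquad v_{\nu,0}^m(z)=-\frac1\pi c(\nu)\langle-\nu-1\rangle_m z^{-\nu-m-1},$$ $$w_{\nu,l}^m(z)=\frac{\nu}{\pi(\nu-l)}c(\nu-l)\langle\nu-1\rangle_m z^{\nu-m-1}\ (l\ge1),\qquad w_{\nu,0}^m(z)=\frac1\pi c(\nu)\langle\nu-1\rangle_m z^{\nu-m-1}.$$ *Claim.* (i) $\mathbf{H}$ satisfies the $G$-type formulas with $P=t$, $Q=u$. (ii) $\mathbf{L}$ satisfies the $F$-type formulas with $P=t$, $Q=u$. (iii) $\mathbf{J}$ satisfies the $G$-type formulas with $P=v$, $Q=w$ for $c(x)=\sin(\pi x)$. (iv) $\mathbf{E}$ satisfies the $G$-type formulas with $P=v$, $Q=w$ for $c(x)=1-\cos(\pi x)$. -/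

import Mathlib

noncomputable section

namespace DerivFormula

/-- The power `z ^ a = exp (a * ℓ z)` attached to a branch `ℓ` of the logarithm. -/
def pow (ℓ : ℂ → ℂ) (a z : ℂ) : ℂ := Complex.exp (a * ℓ z)

/-- For the principal branch one gets the principal power. -/
theorem pow_log (a z : ℂ) (hz : z ≠ 0) : pow Complex.log a z = z ^ a := by
  rw [pow, Complex.cpow_def_of_ne_zero hz, mul_comm]

/-- `(2n)! (ν+2k) ∏_{j<k} (2ν+2j+1) / (2^(2n-k) (2k)! (n-k)! ∏_{j=0}^n (ν+k+j))` for `k ≤ n`,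
where the factor `ν+2k` of the numerator is cancelled against the factor `j = k` of the
denominator (so that the removable singularity at `ν = -2k` is removed). -/
def coeffA (n k : ℕ) (ν : ℂ) : ℂ :=
  ((2 * n).factorial * ∏ j ∈ Finset.range k, (2 * ν + 2 * j + 1)) /
    (2 ^ (2 * n - k) * (2 * k).factorial * (n - k).factorial *
      ∏ j ∈ (Finset.range (n + 1)).erase k, (ν + k + j))

/-- `(2n+1)! (ν+2k+1) ∏_{j<k} (2ν+2j+1) / (2^(2n-k) (2k+1)! (n-k)! ∏_{j=0}^n (ν+k+j+1))` for
`k ≤ n`, where the factor `ν+2k+1` of the numerator is cancelled against the factor `j = k` of the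
denominator (so that the removable singularity at `ν = -2k-1` is removed). -/
def coeffB (n k : ℕ) (ν : ℂ) : ℂ :=
  ((2 * n + 1).factorial * ∏ j ∈ Finset.range k, (2 * ν + 2 * j + 1)) /
    (2 ^ (2 * n - k) * (2 * k + 1).factorial * (n - k).factorial *
      ∏ j ∈ (Finset.range (n + 1)).erase k, (ν + k + j + 1))

theorem coeffA_eq (n k : ℕ) (ν : ℂ) (hk : k ≤ n) (hν : ν + 2 * k ≠ 0) :
    coeffA n k ν =
      ((2 * n).factorial * (ν + 2 * k) * ∏ j ∈ Finset.range k, (2 * ν + 2 * j + 1)) /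
        (2 ^ (2 * n - k) * (2 * k).factorial * (n - k).factorial *
          ∏ j ∈ Finset.range (n + 1), (ν + k + j)) := by
  rw [coeffA, ← Finset.mul_prod_erase (Finset.range (n + 1)) (fun j : ℕ => ν + k + (j : ℂ))
    (Finset.mem_range.2 (Nat.lt_succ_of_le hk)), show ν + k + (k : ℂ) = ν + 2 * k by ring,
    ← mul_div_mul_left _ _ hν]
  congr 1 <;> ring

theorem coeffB_eq (n k : ℕ) (ν : ℂ) (hk : k ≤ n) (hν : ν + 2 * k + 1 ≠ 0) :
    coeffB n k ν =
      ((2 * n + 1).factorial * (ν + 2 * k + 1) * ∏ j ∈ Finset.range k, (2 * ν + 2 * j + 1)) /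
        (2 ^ (2 * n - k) * (2 * k + 1).factorial * (n - k).factorial *
          ∏ j ∈ Finset.range (n + 1), (ν + k + j + 1)) := by
  rw [coeffB, ← Finset.mul_prod_erase (Finset.range (n + 1)) (fun j : ℕ => ν + k + (j : ℂ) + 1)
    (Finset.mem_range.2 (Nat.lt_succ_of_le hk)), show ν + k + (k : ℂ) + 1 = ν + 2 * k + 1 by ring,
    ← mul_div_mul_left _ _ hν]
  congr 1 <;> ring

/-- The Struve function
`H_ν(z) = (z/2)^(ν+1) ∑ₖ (-1)^k (z/2)^(2k) / (Γ(k+3/2) Γ(k+ν+3/2))`, with `(z/2)^(ν+1)` taken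
along the branch `ℓ`.  Here `1/Γ` is entire with zeros at the poles of `Γ`. -/
def struveH (ℓ : ℂ → ℂ) (ν z : ℂ) : ℂ :=
  (1 / 2 : ℂ) ^ (ν + 1) * pow ℓ (ν + 1) z *
    ∑' k : ℕ, (-1) ^ k * (z / 2) ^ (2 * k) *
      ((Complex.Gamma (k + 3 / 2))⁻¹ * (Complex.Gamma (k + ν + 3 / 2))⁻¹)

/-- The modified Struve function
`L_ν(z) = (z/2)^(ν+1) ∑ₖ (z/2)^(2k) / (Γ(k+3/2) Γ(k+ν+3/2))`. -/
def struveL (ℓ : ℂ → ℂ) (ν z : ℂ) : ℂ :=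
  (1 / 2 : ℂ) ^ (ν + 1) * pow ℓ (ν + 1) z *
    ∑' k : ℕ, (z / 2) ^ (2 * k) *
      ((Complex.Gamma (k + 3 / 2))⁻¹ * (Complex.Gamma (k + ν + 3 / 2))⁻¹)

/-- The Anger function `J_ν(z) = (1/π) ∫₀^π cos (ν θ - z sin θ) dθ`. -/
def angerJ (ν z : ℂ) : ℂ :=
  1 / (Real.pi : ℂ) * ∫ θ in (0 : ℝ)..Real.pi, Complex.cos (ν * θ - z * Real.sin θ)

/-- The Weber function `E_ν(z) = (1/π) ∫₀^π sin (ν θ - z sin θ) dθ`. -/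
def weberE (ν z : ℂ) : ℂ :=
  1 / (Real.pi : ℂ) * ∫ θ in (0 : ℝ)..Real.pi, Complex.sin (ν * θ - z * Real.sin θ)

/-- The falling factorial `x (x-1) ⋯ (x-m+1)`, the coefficient in the `m`-th derivative of
`z ^ x`. -/
def falling (x : ℂ) (m : ℕ) : ℂ := (descPochhammer ℂ m).eval x

/-- The terms `t_{ν,l}^m(z)` of the Struve formulas for `z^{-ν} h_ν(z)`. -/
def tTerm (ν : ℂ) (l m : ℕ) (z : ℂ) : ℂ :=
  if l = 0 then
    (1 / 2 : ℂ) ^ ν / (Real.sqrt Real.pi : ℂ) * (Complex.Gamma (ν + 3 / 2))⁻¹ *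
      (if m = 0 then 1 else 0)
  else
    (2 * ν + l) * (1 / 2 : ℂ) ^ (ν + l + 1) / ((Real.sqrt Real.pi : ℂ) * (ν + l)) *
      (Complex.Gamma (ν + l + 3 / 2))⁻¹ * falling l m * z ^ ((l : ℤ) - (m : ℤ))

/-- The terms `u_{ν,l}^m(z)` of the Struve formulas for `z^ν h_ν(z)`. -/
def uTerm (ℓ : ℂ → ℂ) (ν : ℂ) (l m : ℕ) (z : ℂ) : ℂ :=
  if l = 0 then 0
  else
    l * (1 / 2 : ℂ) ^ (ν - l + 1) / ((Real.sqrt Real.pi : ℂ) * (l - ν)) *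
      (Complex.Gamma (ν - l + 3 / 2))⁻¹ * falling (2 * ν - l) m * pow ℓ (2 * ν - l - m) z

/-- The terms `v_{ν,l}^m(z)` of the formulas for `z^{-ν} h_ν(z)`.  The function `c` is
`x ↦ sin (π x)` for the Anger function and `x ↦ 1 - cos (π x)` for the Weber function. -/
def vTerm (c : ℂ → ℂ) (ℓ : ℂ → ℂ) (ν : ℂ) (l m : ℕ) (z : ℂ) : ℂ :=
  if l = 0 then -(1 / Real.pi) * c ν * falling (-ν - 1) m * pow ℓ (-ν - m - 1) z
  else -(ν / (Real.pi * (ν + l))) * c (ν + l) * falling (-ν - 1) m * pow ℓ (-ν - m - 1) z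

/-- The terms `w_{ν,l}^m(z)` of the formulas for `z^ν h_ν(z)`, with `c` as in `vTerm`. -/
def wTerm (c : ℂ → ℂ) (ℓ : ℂ → ℂ) (ν : ℂ) (l m : ℕ) (z : ℂ) : ℂ :=
  if l = 0 then 1 / Real.pi * c ν * falling (ν - 1) m * pow ℓ (ν - m - 1) z
  else ν / (Real.pi * (ν - l)) * c (ν - l) * falling (ν - 1) m * pow ℓ (ν - m - 1) z

def angerC (x : ℂ) : ℂ := Complex.sin (Real.pi * x)

def weberC (x : ℂ) : ℂ := 1 - Complex.cos (Real.pi * x)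

open Finset in
/-- The `F`-type formulas for the derivatives of all orders, on an open set `U` on which `ℓ` is a
branch of the logarithm, of `z^{-ν} F_ν(z)` and `z^ν F_ν(z)`; `P ν l m` and `Q ν l m` stand at the
places of the `m`-th derivatives of `p_{ν,l}` and `q_{ν,l}`. -/
def FormulasF (U : Set ℂ) (ℓ : ℂ → ℂ) (F : ℂ → ℂ → ℂ) (P Q : ℂ → ℕ → ℕ → ℂ → ℂ) : Prop :=
  ∀ ν : ℂ,
    DifferentiableOn ℂ (fun s => F ν s / pow ℓ ν s) U ∧
    DifferentiableOn ℂ (fun s => pow ℓ ν s * F ν s) U ∧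
    ∀ n : ℕ, ∀ z ∈ U,
      ((∀ i ∈ Icc 1 (2 * n - 1), ν ≠ -(i : ℂ)) →
        iteratedDeriv (2 * n) (fun s => F ν s / pow ℓ ν s) z =
          ∑ k ∈ range (n + 1), coeffA n k ν * (F (ν + 2 * k) z / pow ℓ ν z)
          + ∑ j ∈ range n, ∑ k ∈ range (j + 1),
              coeffA j k ν * P ν (2 * k) (2 * n - 2 * j - 1) z
          + ∑ j ∈ range n, ∑ k ∈ range (j + 1),
              coeffB j k ν * P ν (2 * k + 1) (2 * n - 2 * j - 2) z) ∧
      ((∀ i ∈ Icc 1 (2 * n), ν ≠ -(i : ℂ)) →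
        iteratedDeriv (2 * n + 1) (fun s => F ν s / pow ℓ ν s) z =
          ∑ k ∈ range (n + 1), coeffB n k ν * (F (ν + 2 * k + 1) z / pow ℓ ν z)
          + ∑ j ∈ range (n + 1), ∑ k ∈ range (j + 1),
              coeffA j k ν * P ν (2 * k) (2 * n - 2 * j) z
          + ∑ j ∈ range n, ∑ k ∈ range (j + 1),
              coeffB j k ν * P ν (2 * k + 1) (2 * n - 2 * j - 1) z) ∧
      ((∀ i ∈ Icc 1 (2 * n - 1), ν ≠ (i : ℂ)) →
        iteratedDeriv (2 * n) (fun s => pow ℓ ν s * F ν s) z =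
          ∑ k ∈ range (n + 1), coeffA n k (-ν) * (pow ℓ ν z * F (ν - 2 * k) z)
          + ∑ j ∈ range n, ∑ k ∈ range (j + 1),
              coeffA j k (-ν) * Q ν (2 * k) (2 * n - 2 * j - 1) z
          + ∑ j ∈ range n, ∑ k ∈ range (j + 1),
              coeffB j k (-ν) * Q ν (2 * k + 1) (2 * n - 2 * j - 2) z) ∧
      ((∀ i ∈ Icc 1 (2 * n), ν ≠ (i : ℂ)) →
        iteratedDeriv (2 * n + 1) (fun s => pow ℓ ν s * F ν s) z =
          ∑ k ∈ range (n + 1), coeffB n k (-ν) * (pow ℓ ν z * F (ν - 2 * k - 1) z)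
          + ∑ j ∈ range (n + 1), ∑ k ∈ range (j + 1),
              coeffA j k (-ν) * Q ν (2 * k) (2 * n - 2 * j) z
          + ∑ j ∈ range n, ∑ k ∈ range (j + 1),
              coeffB j k (-ν) * Q ν (2 * k + 1) (2 * n - 2 * j - 1) z)

open Finset in
/-- The `G`-type formulas: as `FormulasF`, with alternating signs. -/
def FormulasG (U : Set ℂ) (ℓ : ℂ → ℂ) (G : ℂ → ℂ → ℂ) (P Q : ℂ → ℕ → ℕ → ℂ → ℂ) : Prop :=
  ∀ ν : ℂ,
    DifferentiableOn ℂ (fun s => G ν s / pow ℓ ν s) U ∧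
    DifferentiableOn ℂ (fun s => pow ℓ ν s * G ν s) U ∧
    ∀ n : ℕ, ∀ z ∈ U,
      ((∀ i ∈ Icc 1 (2 * n - 1), ν ≠ -(i : ℂ)) →
        iteratedDeriv (2 * n) (fun s => G ν s / pow ℓ ν s) z =
          ∑ k ∈ range (n + 1),
            (-1) ^ (n + k) * coeffA n k ν * (G (ν + 2 * k) z / pow ℓ ν z)
          + ∑ j ∈ range n, ∑ k ∈ range (j + 1),
              (-1) ^ (k + j) * coeffA j k ν * P ν (2 * k) (2 * n - 2 * j - 1) z
          + ∑ j ∈ range n, ∑ k ∈ range (j + 1),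
              (-1) ^ (k + j + 1) * coeffB j k ν * P ν (2 * k + 1) (2 * n - 2 * j - 2) z) ∧
      ((∀ i ∈ Icc 1 (2 * n), ν ≠ -(i : ℂ)) →
        iteratedDeriv (2 * n + 1) (fun s => G ν s / pow ℓ ν s) z =
          ∑ k ∈ range (n + 1),
            (-1) ^ (n + k + 1) * coeffB n k ν * (G (ν + 2 * k + 1) z / pow ℓ ν z)
          + ∑ j ∈ range (n + 1), ∑ k ∈ range (j + 1),
              (-1) ^ (k + j) * coeffA j k ν * P ν (2 * k) (2 * n - 2 * j) z
          + ∑ j ∈ range n, ∑ k ∈ range (j + 1),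
              (-1) ^ (k + j + 1) * coeffB j k ν * P ν (2 * k + 1) (2 * n - 2 * j - 1) z) ∧
      ((∀ i ∈ Icc 1 (2 * n - 1), ν ≠ (i : ℂ)) →
        iteratedDeriv (2 * n) (fun s => pow ℓ ν s * G ν s) z =
          ∑ k ∈ range (n + 1),
            (-1) ^ (n + k) * coeffA n k (-ν) * (pow ℓ ν z * G (ν - 2 * k) z)
          + ∑ j ∈ range n, ∑ k ∈ range (j + 1),
              (-1) ^ (k + j) * coeffA j k (-ν) * Q ν (2 * k) (2 * n - 2 * j - 1) z
          + ∑ j ∈ range n, ∑ k ∈ range (j + 1),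
              (-1) ^ (k + j) * coeffB j k (-ν) * Q ν (2 * k + 1) (2 * n - 2 * j - 2) z) ∧
      ((∀ i ∈ Icc 1 (2 * n), ν ≠ (i : ℂ)) →
        iteratedDeriv (2 * n + 1) (fun s => pow ℓ ν s * G ν s) z =
          ∑ k ∈ range (n + 1),
            (-1) ^ (n + k) * coeffB n k (-ν) * (pow ℓ ν z * G (ν - 2 * k - 1) z)
          + ∑ j ∈ range (n + 1), ∑ k ∈ range (j + 1),
              (-1) ^ (k + j) * coeffA j k (-ν) * Q ν (2 * k) (2 * n - 2 * j) z
          + ∑ j ∈ range n, ∑ k ∈ range (j + 1),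
              (-1) ^ (k + j) * coeffB j k (-ν) * Q ν (2 * k + 1) (2 * n - 2 * j - 1) z)

end DerivFormula

end

/-! ### Recursions between the coefficients `coeffA` and `coeffB`. -/

noncomputable section
namespace DerivFormula
open Finset

/-! All four functions satisfy a pair of inhomogeneous Bessel-type relations, 2 h_μ' = h_{μ-1} + σ
h_{μ+1} + r₁ and 2 (μ/z) h_μ = h_{μ-1} - σ h_{μ+1} - r₂, with σ² = 1. Put f_l = h_{ν+l} / z^ν. Its
derivative contains (ν/z) h_{ν+l}, which the second relation at μ = ν + l, multiplied by ν/(ν+l),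
removes. The result is f_l' = l/(2(ν+l)) f_{l-1} + σ (2ν+l)/(2(ν+l)) f_{l+1} + P_l, where P_l
collects r₁ and r₂. At l = 0 no division occurs, so ν = 0 is not exceptional.

Iterating this from f_0 visits even and odd indices alternately. The main coefficients are `coeffA`
and `coeffB` because they obey the recursion dual to it (`coeffB_eq_add`, `coeffA_succ_eq_add` and
their boundary cases). Each differentiation also emits one batch of terms P_l, differentiated by all
later steps; this gives the double sums (`iteratedDeriv_eq_formula`). The functions σ^l z^ν h_{ν-l}
satisfy the same relation with -ν for ν, so one iteration serves both families
(`formulas_of_relations`).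

It remains to find r₁ and r₂. For the Struve functions both relations compare weights of power
series terms, and r₁ = r₂ comes from the term k = 0. For the Anger and Weber functions the addition
theorem gives r₁ = 0, and r₂ is the boundary term of an exact integral over [0, π]. -/

/-- The coefficient of `f (l - 1)` in the derivative of `f l`. -/
def lowerCoeff (ν : ℂ) (l : ℕ) : ℂ := l / (2 * (ν + l))

/-- The coefficient of `f (l + 1)` in the derivative of `f l`, up to sign. -/
def raiseCoeff (ν : ℂ) (l : ℕ) : ℂ := if l = 0 then 1 else (2 * ν + l) / (2 * (ν + l))

theorem prod_shift_ne_zero {x : ℂ} {m : ℕ} (h : ∀ j < m, x + j ≠ 0) :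
    ∏ j ∈ range m, (x + j) ≠ 0 :=
  Finset.prod_ne_zero_iff.2 fun j hj => h j (mem_range.1 hj)

theorem prod_shift_succ' (x : ℂ) (m : ℕ) :
    ∏ j ∈ range (m + 1), (x + j) = x * ∏ j ∈ range m, (x + 1 + j) := by
  rw [prod_range_succ', mul_comm]
  simp only [Nat.cast_zero, add_zero, Nat.cast_add, Nat.cast_one]
  congr 1
  exact prod_congr rfl fun j _ => by ring

theorem prod_erase_zero (f : ℕ → ℂ) (n : ℕ) :
    ∏ j ∈ (range (n + 1)).erase 0, f j = ∏ j ∈ range n, f (j + 1) := by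
  have : (range (n + 1)).erase 0 = (range n).image (· + 1) := by
    ext j
    simp only [mem_erase, mem_range, mem_image]
    exact ⟨fun h => ⟨j - 1, by omega, by omega⟩, by rintro ⟨i, hi, rfl⟩; omega⟩
  rw [this, prod_image (by intro a _ b _ h; simpa using h)]

theorem coeffA_self (n : ℕ) (ν : ℂ) :
    coeffA n n ν = (∏ j ∈ range n, (2 * ν + 2 * j + 1)) /
      (2 ^ n * ∏ j ∈ range n, (ν + n + j)) := by
  have h : ((2 * n).factorial : ℂ) ≠ 0 := by exact_mod_cast Nat.factorial_ne_zero _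
  rw [coeffA, range_add_one (n := n), erase_insert (by simp),
    show 2 * n - n = n by omega, ← mul_div_mul_left _ (2 ^ n * _) h]
  congr 1
  simp
  ring

theorem coeffB_self (n : ℕ) (ν : ℂ) :
    coeffB n n ν = (∏ j ∈ range n, (2 * ν + 2 * j + 1)) /
      (2 ^ n * ∏ j ∈ range n, (ν + n + 1 + j)) := by
  have h : ((2 * n + 1).factorial : ℂ) ≠ 0 := by exact_mod_cast Nat.factorial_ne_zero _
  rw [coeffB, range_add_one (n := n), erase_insert (by simp),
    show 2 * n - n = n by omega, ← mul_div_mul_left _ (2 ^ n * _) h]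
  congr 1
  simp only [Nat.sub_self, Nat.factorial_zero, Nat.cast_one, mul_one,
    fun j : ℕ => show ν + n + j + 1 = ν + n + 1 + (j : ℂ) by ring]
  ring

/-- For positive `k`, `raiseCoeff ν (2k)` is (ν+k)/(ν+2k): it cancels the numerator factor ν+2k and
the first factor of the denominator product, so the remaining product starts at ν+k+1. -/
theorem coeffA_mul_raiseCoeff {n k : ℕ} {ν : ℂ} (hk : k ≤ n)
    (h : ∀ i ∈ Icc 1 (2 * n), ν ≠ -(i : ℂ)) :
    coeffA n k ν * raiseCoeff ν (2 * k) =
      (2 * n).factorial * (∏ j ∈ range k, (2 * ν + 2 * j + 1)) /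
        (2 ^ (2 * n - k) * (2 * k).factorial * (n - k).factorial *
          ∏ j ∈ range n, (ν + k + 1 + j)) := by
  -- For `k = 0` the value `ν = 0` is allowed, so the cancelled form of `coeffA` must be used
  -- directly.
  rcases Nat.eq_zero_or_pos k with rfl | hk0
  · have : ∏ j ∈ (range (n + 1)).erase 0, (ν + (0 : ℕ) + (j : ℂ)) =
        ∏ j ∈ range n, (ν + (0 : ℕ) + 1 + (j : ℂ)) := by
      rw [prod_erase_zero]
      exact prod_congr rfl fun j _ => by push_cast; ring
    rw [raiseCoeff, coeffA, this]
    simp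
  · have hne : ∀ i : ℕ, 1 ≤ i → i ≤ 2 * n → ν + i ≠ 0 := fun i h1 h2 h0 =>
      h i (mem_Icc.2 ⟨h1, h2⟩) (eq_neg_of_add_eq_zero_left h0)
    have h2k : ν + 2 * k ≠ 0 := by exact_mod_cast hne (2 * k) (by omega) (by omega)
    have hk1 : ν + k ≠ 0 := hne k (by omega) (by omega)
    have hW : ∏ j ∈ range n, (ν + k + 1 + (j : ℂ)) ≠ 0 := prod_shift_ne_zero fun j hj => by
      convert hne (k + 1 + j) (by omega) (by omega) using 1; push_cast; ring
    have f1 : ((2 * k).factorial : ℂ) ≠ 0 := by exact_mod_cast Nat.factorial_ne_zero _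
    have f2 : ((n - k).factorial : ℂ) ≠ 0 := by exact_mod_cast Nat.factorial_ne_zero _
    rw [coeffA_eq n k ν hk h2k, prod_shift_succ', raiseCoeff, if_neg (by omega)]
    push_cast
    field_simp

/-- Index 2k+1 is reached from 2k by raising and from 2k+2 by lowering. Once the common products are
factored out, this is an identity of rational functions. -/
theorem coeffB_eq_add {n k : ℕ} {ν : ℂ} (hk : k < n) (h : ∀ i ∈ Icc 1 (2 * n), ν ≠ -(i : ℂ)) :
    coeffB n k ν = coeffA n k ν * raiseCoeff ν (2 * k) +
      coeffA n (k + 1) ν * lowerCoeff ν (2 * k + 2) := by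
  have hne : ∀ i : ℕ, 1 ≤ i → i ≤ 2 * n → ν + i ≠ 0 := fun i h1 h2 h0 =>
    h i (mem_Icc.2 ⟨h1, h2⟩) (eq_neg_of_add_eq_zero_left h0)
  have hW : ∏ j ∈ range n, (ν + k + 1 + (j : ℂ)) ≠ 0 := prod_shift_ne_zero fun j hj => by
    convert hne (k + 1 + j) (by omega) (by omega) using 1; push_cast; ring
  have e1 : ν + 2 * k + 1 ≠ 0 := by
    convert hne (2 * k + 1) (by omega) (by omega) using 1; push_cast; ring
  have e2 : ν + 2 * (k + 1 : ℕ) ≠ 0 := by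
    convert hne (2 * k + 2) (by omega) (by omega) using 1; push_cast; ring
  have e3 : ν + k + 1 + n ≠ 0 := by
    convert hne (k + 1 + n) (by omega) (by omega) using 1; push_cast; ring
  rw [coeffA_mul_raiseCoeff hk.le h, coeffA_eq n (k + 1) ν hk e2, coeffB_eq n k ν hk.le e1,
    lowerCoeff]
  simp only [fun j : ℕ => show ν + k + j + 1 = ν + k + 1 + (j : ℂ) by ring,
    fun j : ℕ => show ν + (k + 1 : ℕ) + j = ν + k + 1 + (j : ℂ) by push_cast; ring]
  -- This parametrization removes every truncated subtraction from the exponents and factorials.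
  obtain ⟨d, rfl⟩ : ∃ d, n = k + 1 + d := ⟨n - (k + 1), by omega⟩
  rw [prod_range_succ, prod_range_succ (n := k)]
  rw [show 2 * (k + 1 + d) - k = k + 2 * d + 2 by omega,
    show 2 * (k + 1 + d) - (k + 1) = k + 2 * d + 1 by omega,
    show k + 1 + d - k = d + 1 by omega, show k + 1 + d - (k + 1) = d by omega,
    show 2 * (k + 1) = 2 * k + 1 + 1 by ring]
  have f1 : ((2 * k).factorial : ℂ) ≠ 0 := by exact_mod_cast Nat.factorial_ne_zero _
  have f2 : (d.factorial : ℂ) ≠ 0 := by exact_mod_cast Nat.factorial_ne_zero _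
  have f3 : (d + 1 : ℂ) ≠ 0 := by exact_mod_cast Nat.succ_ne_zero d
  have f4 : (2 * k + 1 : ℂ) ≠ 0 := by exact_mod_cast Nat.succ_ne_zero (2 * k)
  have f5 : (k + 1 : ℂ) ≠ 0 := by exact_mod_cast Nat.succ_ne_zero k
  rw [Nat.factorial_succ (2 * (k + 1 + d)), Nat.factorial_succ (2 * k + 1),
    Nat.factorial_succ (2 * k), Nat.factorial_succ d]
  generalize ∏ j ∈ range (k + 1 + d), (ν + k + 1 + (j : ℂ)) = W at *
  generalize ∏ j ∈ range k, (2 * ν + 2 * j + 1) = R at *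
  push_cast at *
  have e2' : ν + (2 * k + 2) ≠ 0 := by convert e2 using 1; ring
  have e2'' : ν + (2 * k + 1 + 1) ≠ 0 := by convert e2 using 1; ring
  have f6 : (2 * k + 1 + 1 : ℂ) ≠ 0 := by exact_mod_cast Nat.succ_ne_zero (2 * k + 1)
  field_simp
  ring

/-- The top index 2n+1 is reached only by raising 2n. -/
theorem coeffB_self_eq {n : ℕ} {ν : ℂ} (h : ∀ i ∈ Icc 1 (2 * n), ν ≠ -(i : ℂ)) :
    coeffB n n ν = coeffA n n ν * raiseCoeff ν (2 * n) := by
  have f1 : ((2 * n).factorial : ℂ) ≠ 0 := by exact_mod_cast Nat.factorial_ne_zero _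
  rw [coeffA_mul_raiseCoeff le_rfl h, coeffB_self, ← mul_div_mul_left _ (2 ^ n * _) f1,
    show 2 * n - n = n by omega]
  congr 1
  simp
  ring

theorem coeffA_succ_self_eq {n : ℕ} {ν : ℂ} (h : ∀ i ∈ Icc 1 (2 * n + 1), ν ≠ -(i : ℂ)) :
    coeffA (n + 1) (n + 1) ν = coeffB n n ν * raiseCoeff ν (2 * n + 1) := by
  have hne : ∀ i : ℕ, 1 ≤ i → i ≤ 2 * n + 1 → ν + i ≠ 0 := fun i h1 h2 h0 =>
    h i (mem_Icc.2 ⟨h1, h2⟩) (eq_neg_of_add_eq_zero_left h0)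
  have hW : ∏ j ∈ range n, (ν + n + 1 + (j : ℂ)) ≠ 0 := prod_shift_ne_zero fun j hj => by
    convert hne (n + 1 + j) (by omega) (by omega) using 1; push_cast; ring
  have e1 : ν + (2 * n + 1) ≠ 0 := by
    convert hne (2 * n + 1) (by omega) (by omega) using 1; push_cast; ring
  have e2 : ν + n + 1 + n ≠ 0 := by convert e1 using 1; ring
  rw [coeffA_self, coeffB_self, raiseCoeff, if_neg (by omega), prod_range_succ]
  simp only [fun j : ℕ => show ν + (n + 1 : ℕ) + j = ν + n + 1 + (j : ℂ) by push_cast; ring]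
  rw [prod_range_succ]
  push_cast
  field_simp
  ring

theorem coeffA_succ_eq_add {n k : ℕ} {ν : ℂ} (hk : k < n)
    (h : ∀ i ∈ Icc 1 (2 * n + 1), ν ≠ -(i : ℂ)) :
    coeffA (n + 1) (k + 1) ν = coeffB n k ν * raiseCoeff ν (2 * k + 1) +
      coeffB n (k + 1) ν * lowerCoeff ν (2 * k + 3) := by
  have hne : ∀ i : ℕ, 1 ≤ i → i ≤ 2 * n + 1 → ν + i ≠ 0 := fun i h1 h2 h0 =>
    h i (mem_Icc.2 ⟨h1, h2⟩) (eq_neg_of_add_eq_zero_left h0)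
  have hW : ∏ j ∈ range n, (ν + k + 1 + 1 + (j : ℂ)) ≠ 0 := prod_shift_ne_zero fun j hj => by
    convert hne (k + 2 + j) (by omega) (by omega) using 1; push_cast; ring
  have e0 : ν + k + 1 ≠ 0 := by
    convert hne (k + 1) (by omega) (by omega) using 1; push_cast; ring
  have e1 : ν + 2 * k + 1 ≠ 0 := by
    convert hne (2 * k + 1) (by omega) (by omega) using 1; push_cast; ring
  have e2 : ν + 2 * (k + 1 : ℕ) ≠ 0 := by
    convert hne (2 * k + 2) (by omega) (by omega) using 1; push_cast; ring
  have e3 : ν + 2 * (k + 1 : ℕ) + 1 ≠ 0 := by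
    convert hne (2 * k + 3) (by omega) (by omega) using 1; push_cast; ring
  have e4 : ν + k + 1 + 1 + n ≠ 0 := by
    convert hne (k + 2 + n) (by omega) (by omega) using 1; push_cast; ring
  rw [coeffA_eq (n + 1) (k + 1) ν (by omega) e2, coeffB_eq n k ν hk.le e1,
    coeffB_eq n (k + 1) ν hk e3, lowerCoeff, raiseCoeff, if_neg (by omega)]
  simp only [fun j : ℕ => show ν + k + j + 1 = ν + k + 1 + (j : ℂ) by ring,
    fun j : ℕ => show ν + (k + 1 : ℕ) + j = ν + k + 1 + (j : ℂ) by push_cast; ring,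
    fun j : ℕ => show ν + k + 1 + j + 1 = ν + k + 1 + 1 + (j : ℂ) by ring]
  -- The three denominator products are reduced to the common block (ν+k+2)⋯(ν+k+1+n) by splitting
  -- off end factors.
  rw [prod_shift_succ' (ν + k + 1) (n + 1), prod_shift_succ' (ν + k + 1) n,
    prod_range_succ (n := k), prod_range_succ (n := n)]
  obtain ⟨d, rfl⟩ : ∃ d, n = k + 1 + d := ⟨n - (k + 1), by omega⟩
  rw [show 2 * (k + 1 + d) - k = k + 2 * d + 2 by omega,
    show 2 * (k + 1 + d + 1) - (k + 1) = k + 2 * d + 3 by omega,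
    show 2 * (k + 1 + d) - (k + 1) = k + 2 * d + 1 by omega,
    show k + 1 + d + 1 - (k + 1) = d + 1 by omega,
    show k + 1 + d - k = d + 1 by omega, show k + 1 + d - (k + 1) = d by omega,
    show 2 * (k + 1) = 2 * k + 1 + 1 by ring,
    show 2 * (k + 1 + d + 1) = 2 * (k + 1 + d) + 1 + 1 by ring]
  have f1 : ((2 * k).factorial : ℂ) ≠ 0 := by exact_mod_cast Nat.factorial_ne_zero _
  have f2 : (d.factorial : ℂ) ≠ 0 := by exact_mod_cast Nat.factorial_ne_zero _
  have f3 : (d + 1 : ℂ) ≠ 0 := by exact_mod_cast Nat.succ_ne_zero d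
  have f4 : (2 * k + 1 : ℂ) ≠ 0 := by exact_mod_cast Nat.succ_ne_zero (2 * k)
  have f5 : (2 * k + 1 + 1 : ℂ) ≠ 0 := by exact_mod_cast Nat.succ_ne_zero (2 * k + 1)
  have f6 : (2 * k + 1 + 1 + 1 : ℂ) ≠ 0 := by exact_mod_cast Nat.succ_ne_zero (2 * k + 2)
  have f7 : (k + 1 : ℂ) ≠ 0 := by exact_mod_cast Nat.succ_ne_zero k
  have f8 : (2 * k + 3 : ℂ) ≠ 0 := by exact_mod_cast Nat.succ_ne_zero (2 * k + 2)
  rw [Nat.factorial_succ (2 * (k + 1 + d) + 1), Nat.factorial_succ (2 * k + 1 + 1),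
    Nat.factorial_succ (2 * k + 1), Nat.factorial_succ (2 * k), Nat.factorial_succ d]
  generalize ∏ j ∈ range (k + 1 + d), (ν + k + 1 + 1 + (j : ℂ)) = W at *
  generalize ∏ j ∈ range k, (2 * ν + 2 * j + 1) = R at *
  push_cast at *
  have e1' : ν + (2 * k + 1) ≠ 0 := by convert e1 using 1; ring
  have e3' : ν + (2 * k + 3) ≠ 0 := by convert e3 using 1; ring
  have e2' : ν + (2 * k + 1 + 1) ≠ 0 := by convert e2 using 1; ring
  have e3'' : ν + (2 * k + 1 + 1) + 1 ≠ 0 := by convert e3 using 1; ring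
  field_simp
  ring

/-- The bottom index 0 is reached only by lowering 1. Since `ν = 0` is allowed, the erased product
is used as it stands. -/
theorem coeffA_succ_zero_eq {n : ℕ} {ν : ℂ} (h : ∀ i ∈ Icc 1 (2 * n + 1), ν ≠ -(i : ℂ)) :
    coeffA (n + 1) 0 ν = coeffB n 0 ν * lowerCoeff ν 1 := by
  have hne : ∀ i : ℕ, 1 ≤ i → i ≤ 2 * n + 1 → ν + i ≠ 0 := fun i h1 h2 h0 =>
    h i (mem_Icc.2 ⟨h1, h2⟩) (eq_neg_of_add_eq_zero_left h0)
  have e1 : ν + 1 ≠ 0 := by exact_mod_cast hne 1 (by omega) (by omega)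
  have hA : ∏ j ∈ (range (n + 1 + 1)).erase 0, (ν + (0 : ℕ) + (j : ℂ)) =
      ∏ j ∈ range (n + 1), (ν + 1 + (j : ℂ)) := by
    rw [prod_erase_zero]
    exact prod_congr rfl fun j _ => by push_cast; ring
  have hW : ∏ j ∈ range (n + 1), (ν + 1 + (j : ℂ)) ≠ 0 := prod_shift_ne_zero fun j hj => by
    convert hne (1 + j) (by omega) (by omega) using 1; push_cast; ring
  have f2 : (n.factorial : ℂ) ≠ 0 := by exact_mod_cast Nat.factorial_ne_zero _
  have f3 : (n + 1 : ℂ) ≠ 0 := by exact_mod_cast Nat.succ_ne_zero n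
  rw [coeffA, hA, coeffB_eq n 0 ν (Nat.zero_le _) (by simpa using e1), lowerCoeff]
  simp only [fun j : ℕ => show ν + (0 : ℕ) + j + 1 = ν + 1 + (j : ℂ) by push_cast; ring]
  generalize ∏ j ∈ range (n + 1), (ν + 1 + (j : ℂ)) = W at *
  rw [show 2 * (n + 1) - 0 = 2 * n + 2 by omega, show 2 * (n + 1) = 2 * n + 1 + 1 by ring,
    Nat.sub_zero, Nat.sub_zero, Nat.sub_zero, Nat.factorial_succ (2 * n + 1), Nat.factorial_succ n]
  push_cast
  simp
  field_simp
  ring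

end DerivFormula
end

/-! ### Iteration of an abstract raising and lowering relation. -/

noncomputable section
namespace DerivFormula
open Finset

section Abstract

variable (σ ν : ℂ) (f : ℕ → ℂ → ℂ) (P : ℕ → ℕ → ℂ → ℂ)

/-- The right-hand side of the formula for the derivative of order `2 * n` of `f 0`. -/
def evenFormula (n : ℕ) (z : ℂ) : ℂ :=
  ∑ k ∈ range (n + 1), σ ^ (n + k) * coeffA n k ν * f (2 * k) z
    + ∑ j ∈ range n, ∑ k ∈ range (j + 1),
        σ ^ (k + j) * coeffA j k ν * P (2 * k) (2 * n - 2 * j - 1) z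
    + ∑ j ∈ range n, ∑ k ∈ range (j + 1),
        σ ^ (k + j + 1) * coeffB j k ν * P (2 * k + 1) (2 * n - 2 * j - 2) z

/-- The right-hand side of the formula for the derivative of order `2 * n + 1` of `f 0`. -/
def oddFormula (n : ℕ) (z : ℂ) : ℂ :=
  ∑ k ∈ range (n + 1), σ ^ (n + k + 1) * coeffB n k ν * f (2 * k + 1) z
    + ∑ j ∈ range (n + 1), ∑ k ∈ range (j + 1),
        σ ^ (k + j) * coeffA j k ν * P (2 * k) (2 * n - 2 * j) z
    + ∑ j ∈ range n, ∑ k ∈ range (j + 1),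
        σ ^ (k + j + 1) * coeffB j k ν * P (2 * k + 1) (2 * n - 2 * j - 1) z

variable {σ ν f P}

theorem sum_coeffA_raise_lower {n : ℕ} (h : ∀ i ∈ Icc 1 (2 * n), ν ≠ -(i : ℂ)) (g : ℕ → ℂ) :
    ∑ k ∈ range (n + 1), σ ^ (n + k) * coeffA n k ν *
        (lowerCoeff ν (2 * k) * g (2 * k - 1) + σ * (raiseCoeff ν (2 * k) * g (2 * k + 1))) =
      ∑ k ∈ range (n + 1), σ ^ (n + k + 1) * coeffB n k ν * g (2 * k + 1) := by
  simp only [mul_add, sum_add_distrib]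
  rw [sum_range_succ', sum_range_succ _ n, sum_range_succ _ n, coeffB_self_eq h]
  -- At `k = 0` the index `2 * k - 1` truncates to 0; the vanishing coefficient makes that term
  -- harmless.
  have h0 : lowerCoeff ν (2 * 0) = 0 := by simp [lowerCoeff]
  rw [h0]
  have : ∑ k ∈ range n, σ ^ (n + k + 1) * coeffB n k ν * g (2 * k + 1) =
      ∑ k ∈ range n, σ ^ (n + (k + 1)) * coeffA n (k + 1) ν *
        (lowerCoeff ν (2 * (k + 1)) * g (2 * (k + 1) - 1)) +
      ∑ k ∈ range n, σ ^ (n + k) * coeffA n k ν *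
        (σ * (raiseCoeff ν (2 * k) * g (2 * k + 1))) := by
    rw [← sum_add_distrib]
    refine sum_congr rfl fun k hk => ?_
    rw [coeffB_eq_add (mem_range.1 hk) h, show 2 * (k + 1) - 1 = 2 * k + 1 by omega,
      show 2 * (k + 1) = 2 * k + 2 by ring]
    ring
  rw [this]
  ring

/-- Collecting by index, `g 0` arises from lowering alone, `g (2n+2)` from raising alone, and each
index between from both. -/
theorem sum_coeffB_raise_lower {n : ℕ} (h : ∀ i ∈ Icc 1 (2 * n + 1), ν ≠ -(i : ℂ)) (g : ℕ → ℂ) :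
    ∑ k ∈ range (n + 1), σ ^ (n + k + 1) * coeffB n k ν *
        (lowerCoeff ν (2 * k + 1) * g (2 * k) +
          σ * (raiseCoeff ν (2 * k + 1) * g (2 * k + 2))) =
      ∑ k ∈ range (n + 1 + 1), σ ^ (n + 1 + k) * coeffA (n + 1) k ν * g (2 * k) := by
  simp only [mul_add, sum_add_distrib]
  rw [sum_range_succ' _ n, sum_range_succ _ n, sum_range_succ' _ (n + 1), sum_range_succ _ n,
    coeffA_succ_self_eq h, coeffA_succ_zero_eq h]
  have : ∑ k ∈ range n, σ ^ (n + 1 + (k + 1)) * coeffA (n + 1) (k + 1) ν * g (2 * (k + 1)) =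
      ∑ k ∈ range n, σ ^ (n + (k + 1) + 1) * coeffB n (k + 1) ν *
        (lowerCoeff ν (2 * (k + 1) + 1) * g (2 * (k + 1))) +
      ∑ k ∈ range n, σ ^ (n + k + 1) * coeffB n k ν *
        (σ * (raiseCoeff ν (2 * k + 1) * g (2 * k + 2))) := by
    rw [← sum_add_distrib]
    refine sum_congr rfl fun k hk => ?_
    rw [coeffA_succ_eq_add (mem_range.1 hk) h, show 2 * (k + 1) = 2 * k + 2 by ring]
    ring
  rw [this, show 2 * (n + 1) = 2 * n + 2 by ring]
  simp only [mul_zero, zero_add, add_zero]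
  ring

variable {U : Set ℂ}

theorem hasDerivAt_evenFormula
    (hP : ∀ l m, ∀ z ∈ U, HasDerivAt (P l m) (P l (m + 1) z) z)
    (hf : ∀ l : ℕ, (l ≠ 0 → ν ≠ -(l : ℂ)) → ∀ z ∈ U, HasDerivAt (f l)
      (lowerCoeff ν l * f (l - 1) z + σ * (raiseCoeff ν l * f (l + 1) z) + P l 0 z) z)
    {n : ℕ} (h : ∀ i ∈ Icc 1 (2 * n), ν ≠ -(i : ℂ)) {z : ℂ} (hz : z ∈ U) :
    HasDerivAt (evenFormula σ ν f P n) (oddFormula σ ν f P n z) z := by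
  have h1 : HasDerivAt (evenFormula σ ν f P n) _ z :=
    ((HasDerivAt.fun_sum fun k (hk : k ∈ range (n + 1)) =>
      (hf (2 * k) (fun h0 => h _ (mem_Icc.2 ⟨by omega, by have := mem_range.1 hk; omega⟩)) z
        hz).const_mul (σ ^ (n + k) * coeffA n k ν)).fun_add
    (HasDerivAt.fun_sum fun j (_ : j ∈ range n) =>
      HasDerivAt.fun_sum fun k (_ : k ∈ range (j + 1)) =>
        (hP (2 * k) (2 * n - 2 * j - 1) z hz).const_mul (σ ^ (k + j) * coeffA j k ν))).fun_add
    (HasDerivAt.fun_sum fun j (_ : j ∈ range n) =>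
      HasDerivAt.fun_sum fun k (_ : k ∈ range (j + 1)) =>
        (hP (2 * k + 1) (2 * n - 2 * j - 2) z hz).const_mul (σ ^ (k + j + 1) * coeffB j k ν))
  convert h1 using 1
  -- The remainders emitted by the main sum form the new block `j = n`; older blocks gain one
  -- derivative. The main sum has even indices only, so the `coeffB` double sum gets no new block.
  have e1 : ∑ j ∈ range (n + 1), ∑ k ∈ range (j + 1),
        σ ^ (k + j) * coeffA j k ν * P (2 * k) (2 * n - 2 * j) z =
      ∑ j ∈ range n, ∑ k ∈ range (j + 1),
        σ ^ (k + j) * coeffA j k ν * P (2 * k) (2 * n - 2 * j - 1 + 1) z +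
      ∑ k ∈ range (n + 1), σ ^ (n + k) * coeffA n k ν * P (2 * k) 0 z := by
    rw [sum_range_succ _ n]
    congr 1
    · exact sum_congr rfl fun j hj => by
        have := mem_range.1 hj
        rw [show 2 * n - 2 * j - 1 + 1 = 2 * n - 2 * j by omega]
    · exact sum_congr rfl fun k hk => by rw [Nat.sub_self, add_comm k n]
  have e2 : ∑ j ∈ range n, ∑ k ∈ range (j + 1),
        σ ^ (k + j + 1) * coeffB j k ν * P (2 * k + 1) (2 * n - 2 * j - 1) z =
      ∑ j ∈ range n, ∑ k ∈ range (j + 1),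
        σ ^ (k + j + 1) * coeffB j k ν * P (2 * k + 1) (2 * n - 2 * j - 2 + 1) z :=
    sum_congr rfl fun j hj => by
      have := mem_range.1 hj
      rw [show 2 * n - 2 * j - 1 = 2 * n - 2 * j - 2 + 1 by omega]
  rw [oddFormula, ← sum_coeffA_raise_lower h (fun l => f l z), e1, e2]
  simp only [mul_add, sum_add_distrib]
  ring

theorem hasDerivAt_oddFormula
    (hP : ∀ l m, ∀ z ∈ U, HasDerivAt (P l m) (P l (m + 1) z) z)
    (hf : ∀ l : ℕ, (l ≠ 0 → ν ≠ -(l : ℂ)) → ∀ z ∈ U, HasDerivAt (f l)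
      (lowerCoeff ν l * f (l - 1) z + σ * (raiseCoeff ν l * f (l + 1) z) + P l 0 z) z)
    {n : ℕ} (h : ∀ i ∈ Icc 1 (2 * n + 1), ν ≠ -(i : ℂ)) {z : ℂ} (hz : z ∈ U) :
    HasDerivAt (oddFormula σ ν f P n) (evenFormula σ ν f P (n + 1) z) z := by
  have h1 : HasDerivAt (oddFormula σ ν f P n) _ z :=
    ((HasDerivAt.fun_sum fun k (hk : k ∈ range (n + 1)) =>
      (hf (2 * k + 1) (fun h0 => h _ (mem_Icc.2 ⟨by omega, by have := mem_range.1 hk; omega⟩)) z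
        hz).const_mul (σ ^ (n + k + 1) * coeffB n k ν)).fun_add
    (HasDerivAt.fun_sum fun j (_ : j ∈ range (n + 1)) =>
      HasDerivAt.fun_sum fun k (_ : k ∈ range (j + 1)) =>
        (hP (2 * k) (2 * n - 2 * j) z hz).const_mul (σ ^ (k + j) * coeffA j k ν))).fun_add
    (HasDerivAt.fun_sum fun j (_ : j ∈ range n) =>
      HasDerivAt.fun_sum fun k (_ : k ∈ range (j + 1)) =>
        (hP (2 * k + 1) (2 * n - 2 * j - 1) z hz).const_mul (σ ^ (k + j + 1) * coeffB j k ν))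
  convert h1 using 1
  have e1 : ∑ j ∈ range (n + 1), ∑ k ∈ range (j + 1),
        σ ^ (k + j) * coeffA j k ν * P (2 * k) (2 * (n + 1) - 2 * j - 1) z =
      ∑ j ∈ range (n + 1), ∑ k ∈ range (j + 1),
        σ ^ (k + j) * coeffA j k ν * P (2 * k) (2 * n - 2 * j + 1) z :=
    sum_congr rfl fun j hj => by
      have := mem_range.1 hj
      rw [show 2 * (n + 1) - 2 * j - 1 = 2 * n - 2 * j + 1 by omega]
  -- Here the main sum has odd indices, so the new block `j = n` belongs to the `coeffB` sum.
  have e2 : ∑ j ∈ range (n + 1), ∑ k ∈ range (j + 1),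
        σ ^ (k + j + 1) * coeffB j k ν * P (2 * k + 1) (2 * (n + 1) - 2 * j - 2) z =
      ∑ j ∈ range n, ∑ k ∈ range (j + 1),
        σ ^ (k + j + 1) * coeffB j k ν * P (2 * k + 1) (2 * n - 2 * j - 1 + 1) z +
      ∑ k ∈ range (n + 1), σ ^ (n + k + 1) * coeffB n k ν * P (2 * k + 1) 0 z := by
    rw [sum_range_succ _ n]
    congr 1
    · exact sum_congr rfl fun j hj => by
        have := mem_range.1 hj
        rw [show 2 * (n + 1) - 2 * j - 2 = 2 * n - 2 * j - 1 + 1 by omega]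
    · exact sum_congr rfl fun k hk => by
        rw [show 2 * (n + 1) - 2 * n - 2 = 0 by omega, add_comm k n]
  rw [evenFormula, ← sum_coeffB_raise_lower h (fun l => f l z), e1, e2]
  simp only [mul_add, sum_add_distrib, Nat.add_sub_cancel]
  ring

theorem iteratedDeriv_eq_formula (hU : IsOpen U)
    (hP : ∀ l m, ∀ z ∈ U, HasDerivAt (P l m) (P l (m + 1) z) z)
    (hf : ∀ l : ℕ, (l ≠ 0 → ν ≠ -(l : ℂ)) → ∀ z ∈ U, HasDerivAt (f l)
      (lowerCoeff ν l * f (l - 1) z + σ * (raiseCoeff ν l * f (l + 1) z) + P l 0 z) z)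
    (n : ℕ) :
    ((∀ i ∈ Icc 1 (2 * n - 1), ν ≠ -(i : ℂ)) → ∀ z ∈ U,
      iteratedDeriv (2 * n) (f 0) z = evenFormula σ ν f P n z) ∧
    ((∀ i ∈ Icc 1 (2 * n), ν ≠ -(i : ℂ)) → ∀ z ∈ U,
      iteratedDeriv (2 * n + 1) (f 0) z = oddFormula σ ν f P n z) := by
  -- Equality on the open set `U` is equality of germs at its points, hence may be differentiated.
  have step : ∀ {m : ℕ} {g g' : ℂ → ℂ}, (∀ z ∈ U, iteratedDeriv m (f 0) z = g z) →
      (∀ z ∈ U, HasDerivAt g (g' z) z) → ∀ z ∈ U, iteratedDeriv (m + 1) (f 0) z = g' z := by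
    intro m g g' h1 h2 z hz
    rw [iteratedDeriv_succ]
    exact (Filter.EventuallyEq.deriv_eq
      (Filter.eventually_of_mem (hU.mem_nhds hz) h1)).trans (h2 z hz).deriv
  have odd : ∀ n : ℕ, ((∀ i ∈ Icc 1 (2 * n - 1), ν ≠ -(i : ℂ)) → ∀ z ∈ U,
      iteratedDeriv (2 * n) (f 0) z = evenFormula σ ν f P n z) →
      (∀ i ∈ Icc 1 (2 * n), ν ≠ -(i : ℂ)) → ∀ z ∈ U,
      iteratedDeriv (2 * n + 1) (f 0) z = oddFormula σ ν f P n z := fun n ih h =>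
    step (ih fun i hi => h i (Icc_subset_Icc_right (by omega) hi))
      fun z hz => hasDerivAt_evenFormula hP hf h hz
  induction n with
  | zero =>
    have h0 : (∀ i : ℕ, i ∈ Icc 1 (2 * 0 - 1) → ν ≠ -(i : ℂ)) → ∀ z ∈ U,
        iteratedDeriv (2 * 0) (f 0) z = evenFormula σ ν f P 0 z := by
      intro _ z _
      simp [evenFormula, coeffA]
    exact ⟨h0, odd 0 h0⟩
  | succ n ih =>
    have h0 : (∀ i : ℕ, i ∈ Icc 1 (2 * (n + 1) - 1) → ν ≠ -(i : ℂ)) → ∀ z ∈ U,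
        iteratedDeriv (2 * (n + 1)) (f 0) z = evenFormula σ ν f P (n + 1) z := by
      intro h
      exact step (ih.2 fun i hi => h i (Icc_subset_Icc_right (by omega) hi))
        fun z hz => hasDerivAt_oddFormula hP hf h hz
    exact ⟨h0, odd (n + 1) h0⟩

end Abstract

end DerivFormula
end

/-! ### Powers along a branch, and reduction to two three-term relations. -/

noncomputable section
namespace DerivFormula
open Finset

section Branch

variable {U : Set ℂ} {ℓ : ℂ → ℂ}

/-- A continuous right inverse of `exp` is differentiable, with derivative 1 / exp (ℓ z). -/
theorem hasDerivAt_branch (hU : IsOpen U) (hcont : ContinuousOn ℓ U)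
    (hexp : ∀ z ∈ U, Complex.exp (ℓ z) = z) {z : ℂ} (hz : z ∈ U) : HasDerivAt ℓ z⁻¹ z := by
  have h := (Complex.hasDerivAt_exp (ℓ z)).of_local_left_inverse
    (hcont.continuousAt (hU.mem_nhds hz)) (Complex.exp_ne_zero _)
    (Filter.eventually_of_mem (hU.mem_nhds hz) hexp)
  rwa [hexp z hz] at h

theorem pow_ne_zero' (a z : ℂ) : pow ℓ a z ≠ 0 := Complex.exp_ne_zero _

theorem pow_add (a b z : ℂ) : pow ℓ (a + b) z = pow ℓ a z * pow ℓ b z := by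
  rw [pow, add_mul, Complex.exp_add, pow, pow]

theorem pow_sub (a b z : ℂ) : pow ℓ (a - b) z = pow ℓ a z / pow ℓ b z := by
  rw [pow, sub_mul, Complex.exp_sub, pow, pow]

theorem pow_neg (a z : ℂ) : pow ℓ (-a) z = (pow ℓ a z)⁻¹ := by
  rw [pow, neg_mul, Complex.exp_neg, pow]

theorem pow_natCast {z : ℂ} (hz : Complex.exp (ℓ z) = z) (n : ℕ) : pow ℓ n z = z ^ n := by
  rw [pow, Complex.exp_nat_mul, hz]

theorem pow_one' {z : ℂ} (hz : Complex.exp (ℓ z) = z) : pow ℓ 1 z = z := by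
  simpa using pow_natCast hz 1

theorem ne_zero_of_branch {z : ℂ} (hz : Complex.exp (ℓ z) = z) : z ≠ 0 :=
  hz ▸ Complex.exp_ne_zero _

theorem pow_sub_one {z : ℂ} (hz : Complex.exp (ℓ z) = z) (a : ℂ) :
    pow ℓ (a - 1) z = pow ℓ a z / z := by
  rw [pow_sub, pow_one' hz]

theorem hasDerivAt_pow {z : ℂ} (hℓ : HasDerivAt ℓ z⁻¹ z) (hz : Complex.exp (ℓ z) = z) (a : ℂ) :
    HasDerivAt (pow ℓ a) (a * pow ℓ (a - 1) z) z := by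
  have h := (hℓ.const_mul a).cexp
  refine HasDerivAt.congr_deriv h (Eq.symm ?_)
  rw [pow_sub_one hz, pow]
  ring

theorem falling_succ (x : ℂ) (m : ℕ) : falling x (m + 1) = falling x m * (x - m) := by
  rw [falling, descPochhammer_succ_eval, falling]

theorem falling_zero (x : ℂ) : falling x 0 = 1 := by simp [falling]

theorem hasDerivAt_falling_mul_pow {z : ℂ} (hℓ : HasDerivAt ℓ z⁻¹ z) (hz : Complex.exp (ℓ z) = z)
    (x : ℂ) (m : ℕ) :
    HasDerivAt (fun s => falling x m * pow ℓ (x - m) s)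
      (falling x (m + 1) * pow ℓ (x - (m + 1 : ℕ)) z) z := by
  refine HasDerivAt.congr_deriv ((hasDerivAt_pow hℓ hz (x - m)).const_mul (falling x m))
    (Eq.symm ?_)
  rw [falling_succ, Nat.cast_succ, sub_sub]
  ring

end Branch

/-- The formulas for the derivatives of all orders of `h ν / z ^ ν` and `z ^ ν * h ν`, with
a general sign `σ`. -/
def Formulas (σ : ℂ) (U : Set ℂ) (ℓ : ℂ → ℂ) (h : ℂ → ℂ → ℂ) (P Q : ℂ → ℕ → ℕ → ℂ → ℂ) : Prop :=
  ∀ ν : ℂ,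
    DifferentiableOn ℂ (fun s => h ν s / pow ℓ ν s) U ∧
    DifferentiableOn ℂ (fun s => pow ℓ ν s * h ν s) U ∧
    ∀ n : ℕ, ∀ z ∈ U,
      ((∀ i ∈ Icc 1 (2 * n - 1), ν ≠ -(i : ℂ)) →
        iteratedDeriv (2 * n) (fun s => h ν s / pow ℓ ν s) z =
          ∑ k ∈ range (n + 1),
            σ ^ (n + k) * coeffA n k ν * (h (ν + 2 * k) z / pow ℓ ν z)
          + ∑ j ∈ range n, ∑ k ∈ range (j + 1),
              σ ^ (k + j) * coeffA j k ν * P ν (2 * k) (2 * n - 2 * j - 1) z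
          + ∑ j ∈ range n, ∑ k ∈ range (j + 1),
              σ ^ (k + j + 1) * coeffB j k ν * P ν (2 * k + 1) (2 * n - 2 * j - 2) z) ∧
      ((∀ i ∈ Icc 1 (2 * n), ν ≠ -(i : ℂ)) →
        iteratedDeriv (2 * n + 1) (fun s => h ν s / pow ℓ ν s) z =
          ∑ k ∈ range (n + 1),
            σ ^ (n + k + 1) * coeffB n k ν * (h (ν + 2 * k + 1) z / pow ℓ ν z)
          + ∑ j ∈ range (n + 1), ∑ k ∈ range (j + 1),
              σ ^ (k + j) * coeffA j k ν * P ν (2 * k) (2 * n - 2 * j) z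
          + ∑ j ∈ range n, ∑ k ∈ range (j + 1),
              σ ^ (k + j + 1) * coeffB j k ν * P ν (2 * k + 1) (2 * n - 2 * j - 1) z) ∧
      ((∀ i ∈ Icc 1 (2 * n - 1), ν ≠ (i : ℂ)) →
        iteratedDeriv (2 * n) (fun s => pow ℓ ν s * h ν s) z =
          ∑ k ∈ range (n + 1),
            σ ^ (n + k) * coeffA n k (-ν) * (pow ℓ ν z * h (ν - 2 * k) z)
          + ∑ j ∈ range n, ∑ k ∈ range (j + 1),
              σ ^ (k + j) * coeffA j k (-ν) * Q ν (2 * k) (2 * n - 2 * j - 1) z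
          + ∑ j ∈ range n, ∑ k ∈ range (j + 1),
              σ ^ (k + j) * coeffB j k (-ν) * Q ν (2 * k + 1) (2 * n - 2 * j - 2) z) ∧
      ((∀ i ∈ Icc 1 (2 * n), ν ≠ (i : ℂ)) →
        iteratedDeriv (2 * n + 1) (fun s => pow ℓ ν s * h ν s) z =
          ∑ k ∈ range (n + 1),
            σ ^ (n + k) * coeffB n k (-ν) * (pow ℓ ν z * h (ν - 2 * k - 1) z)
          + ∑ j ∈ range (n + 1), ∑ k ∈ range (j + 1),
              σ ^ (k + j) * coeffA j k (-ν) * Q ν (2 * k) (2 * n - 2 * j) z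
          + ∑ j ∈ range n, ∑ k ∈ range (j + 1),
              σ ^ (k + j) * coeffB j k (-ν) * Q ν (2 * k + 1) (2 * n - 2 * j - 1) z)

theorem Formulas.formulasF {U : Set ℂ} {ℓ : ℂ → ℂ} {h : ℂ → ℂ → ℂ} {P Q : ℂ → ℕ → ℕ → ℂ → ℂ}
    (H : Formulas 1 U ℓ h P Q) : FormulasF U ℓ h P Q := by
  simpa only [Formulas, FormulasF, one_pow, one_mul] using H

theorem Formulas.formulasG {U : Set ℂ} {ℓ : ℂ → ℂ} {h : ℂ → ℂ → ℂ} {P Q : ℂ → ℕ → ℕ → ℂ → ℂ}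
    (H : Formulas (-1) U ℓ h P Q) : FormulasG U ℓ h P Q := H

section Relations

variable {U : Set ℂ} {ℓ : ℂ → ℂ} {σ : ℂ} {h r₁ r₂ : ℂ → ℂ → ℂ} {P Q : ℂ → ℕ → ℕ → ℂ → ℂ}

theorem hasDerivAt_div_pow {z : ℂ} (hℓ : HasDerivAt ℓ z⁻¹ z) (hz : Complex.exp (ℓ z) = z)
    {g : ℂ → ℂ} {g' : ℂ} (hg : HasDerivAt g g' z) (ν : ℂ) :
    HasDerivAt (fun s => g s / pow ℓ ν s) ((g' - ν / z * g z) / pow ℓ ν z) z := by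
  have hz0 := ne_zero_of_branch hz
  have hp : pow ℓ ν z ≠ 0 := pow_ne_zero' ν z
  refine HasDerivAt.congr_deriv (hg.fun_div (hasDerivAt_pow hℓ hz ν) hp) (Eq.symm ?_)
  rw [pow_sub_one hz]
  field_simp

theorem hasDerivAt_pow_mul {z : ℂ} (hℓ : HasDerivAt ℓ z⁻¹ z) (hz : Complex.exp (ℓ z) = z)
    {g : ℂ → ℂ} {g' : ℂ} (hg : HasDerivAt g g' z) (ν : ℂ) :
    HasDerivAt (fun s => pow ℓ ν s * g s) (pow ℓ ν z * (g' + ν / z * g z)) z := by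
  refine HasDerivAt.congr_deriv ((hasDerivAt_pow hℓ hz ν).fun_mul hg) (Eq.symm ?_)
  rw [pow_sub_one hz]
  ring

/-- The formulas for the derivatives of all orders follow from the two three-term relations
for `h`. -/
theorem formulas_of_relations (hU : IsOpen U) (hℓ : ∀ z ∈ U, HasDerivAt ℓ z⁻¹ z)
    (hexp : ∀ z ∈ U, Complex.exp (ℓ z) = z) (hσ : σ ^ 2 = 1)
    (hd : ∀ μ, ∀ z ∈ U, HasDerivAt (h μ) ((h (μ - 1) z + σ * h (μ + 1) z + r₁ μ z) / 2) z)
    (hr : ∀ μ, ∀ z ∈ U, 2 * (μ / z * h μ z) = h (μ - 1) z - σ * h (μ + 1) z - r₂ μ z)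
    (hP : ∀ ν l m, ∀ z ∈ U, HasDerivAt (P ν l m) (P ν l (m + 1) z) z)
    (hQ : ∀ ν l m, ∀ z ∈ U, HasDerivAt (Q ν l m) (Q ν l (m + 1) z) z)
    (hP0 : ∀ ν, ∀ z ∈ U, P ν 0 0 z = (r₁ ν z + r₂ ν z) / 2 / pow ℓ ν z)
    (hPl : ∀ (ν : ℂ) (l : ℕ), l ≠ 0 → ν + l ≠ 0 → ∀ z ∈ U, P ν l 0 z =
      (r₁ (ν + l) z + ν / (ν + l) * r₂ (ν + l) z) / 2 / pow ℓ ν z)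
    (hQ0 : ∀ ν, ∀ z ∈ U, Q ν 0 0 z = pow ℓ ν z * ((r₁ ν z - r₂ ν z) / 2))
    (hQl : ∀ (ν : ℂ) (l : ℕ), l ≠ 0 → ν - l ≠ 0 → ∀ z ∈ U, Q ν l 0 z =
      pow ℓ ν z * ((r₁ (ν - l) z - ν / (ν - l) * r₂ (ν - l) z) / 2)) :
    Formulas σ U ℓ h P Q := by
  intro ν
  refine ⟨fun z hz => (hasDerivAt_div_pow (hℓ z hz) (hexp z hz)
      (hd ν z hz) ν).differentiableAt.differentiableWithinAt,
    fun z hz => (hasDerivAt_pow_mul (hℓ z hz) (hexp z hz)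
      (hd ν z hz) ν).differentiableAt.differentiableWithinAt, fun n z hz => ?_⟩
  have key₁ := iteratedDeriv_eq_formula (σ := σ) (ν := ν)
    (f := fun l s => h (ν + l) s / pow ℓ ν s) (P := P ν) hU (hP ν) (fun l hl z hz => by
      refine HasDerivAt.congr_deriv
        (hasDerivAt_div_pow (hℓ z hz) (hexp z hz) (hd (ν + l) z hz) ν) (Eq.symm ?_)
      have hp : pow ℓ ν z ≠ 0 := pow_ne_zero' ν z
      have hr' := hr (ν + l) z hz
      -- At `l = 0` the recurrence is used without dividing by its index, which may vanish.
      rcases l with _ | l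
      · rw [hP0 ν z hz, lowerCoeff, raiseCoeff]
        simp only [Nat.cast_zero, add_zero, zero_add, Nat.cast_one, if_true, zero_div] at hr' ⊢
        field_simp
        linear_combination hr'
      · have hl' : ν + (l + 1 : ℕ) ≠ 0 := fun h0 =>
          hl (by omega) (eq_neg_of_add_eq_zero_left h0)
        rw [hPl ν _ (by omega) hl' z hz, lowerCoeff, raiseCoeff, if_neg (by omega)]
        rw [show ν + ((l + 1 : ℕ) : ℂ) - 1 = ν + l by push_cast; ring,
          show ν + ((l + 1 : ℕ) : ℂ) + 1 = ν + (l + 1 + 1 : ℕ) by push_cast; ring] at *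
        rw [Nat.add_sub_cancel]
        have hz0 := ne_zero_of_branch (hexp z hz)
        generalize r₁ (ν + (l + 1 : ℕ)) z = R₁ at *
        generalize r₂ (ν + (l + 1 : ℕ)) z = R₂ at *
        generalize h (ν + (l + 1 : ℕ)) z = H at *
        generalize h (ν + (l + 1 + 1 : ℕ)) z = H₂ at *
        generalize h (ν + l) z = H₁ at *
        have hH : ν / z * H = ν / (ν + (l + 1 : ℕ)) * ((H₁ - σ * H₂ - R₂) / 2) := by
          rw [← hr']
          field_simp
        rw [hH]
        field_simp
        push_cast
        ring) n
  -- For z^ν h_{ν-l} the factor σ sits on the step decreasing `l` instead of the one increasing it.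
  -- Scaling by `σ ^ l` moves it to the other step, because σ² = 1.
  have key₂ := iteratedDeriv_eq_formula (σ := σ) (ν := -ν)
    (f := fun l s => σ ^ l * (pow ℓ ν s * h (ν - l) s)) (P := fun l m s => σ ^ l * Q ν l m s) hU
    (fun l m z hz => (hQ ν l m z hz).const_mul _) (fun l hl z hz => by
      refine HasDerivAt.congr_deriv
        ((hasDerivAt_pow_mul (hℓ z hz) (hexp z hz) (hd (ν - l) z hz) ν).const_mul (σ ^ l))
        (Eq.symm ?_)
      have hr' := hr (ν - l) z hz
      rcases l with _ | l
      · rw [hQ0 ν z hz, lowerCoeff, raiseCoeff]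
        simp only [Nat.cast_zero, sub_zero, zero_add, Nat.cast_one, if_true, zero_div, pow_zero,
          _root_.pow_one] at hr' ⊢
        linear_combination (pow ℓ ν z * h (ν - 1) z) * hσ - pow ℓ ν z / 2 * hr'
      · have hl' : -ν + (l + 1 : ℕ) ≠ 0 := fun h0 =>
          hl (by omega) (eq_neg_of_add_eq_zero_left h0)
        have hl'' : ν - (l + 1 : ℕ) ≠ 0 := fun h0 => hl' (by linear_combination -h0)
        rw [hQl ν _ (by omega) hl'' z hz, lowerCoeff, raiseCoeff, if_neg (by omega)]
        rw [show ν - ((l + 1 : ℕ) : ℂ) - 1 = ν - (l + 1 + 1 : ℕ) by push_cast; ring,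
          show ν - ((l + 1 : ℕ) : ℂ) + 1 = ν - l by push_cast; ring] at *
        rw [Nat.add_sub_cancel]
        have hz0 := ne_zero_of_branch (hexp z hz)
        generalize r₁ (ν - (l + 1 : ℕ)) z = R₁ at *
        generalize r₂ (ν - (l + 1 : ℕ)) z = R₂ at *
        generalize h (ν - (l + 1 : ℕ)) z = H at *
        generalize h (ν - (l + 1 + 1 : ℕ)) z = H₁ at *
        generalize h (ν - l) z = H₂ at *
        have hH : ν / z * H = ν / (ν - (l + 1 : ℕ)) * ((H₁ - σ * H₂ - R₂) / 2) := by
          rw [← hr']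
          field_simp
        have e1 : (-ν + (l + 1 : ℕ)) = -(ν - (l + 1 : ℕ)) := by ring
        rw [hH, e1]
        have hp3 : σ ^ (l + 1 + 1) = σ ^ l := by
          rw [_root_.pow_add, _root_.pow_add]
          linear_combination σ ^ l * hσ
        have hp2 : σ ^ (l + 1) = σ ^ l * σ := pow_succ _ _
        have hp4 : σ * σ = 1 := by rw [← sq, hσ]
        have hL : ((l + 1 : ℕ) : ℂ) = ν - (ν - (l + 1 : ℕ)) := by ring
        generalize hM : ν - ((l + 1 : ℕ) : ℂ) = M at *
        have e2 : σ ^ l * σ * (pow ℓ ν z * ((H₁ + σ * H₂ + R₁) / 2 +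
            ν / M * ((H₁ - σ * H₂ - R₂) / 2))) =
            σ ^ l * (pow ℓ ν z * ((σ * H₁ + H₂ + σ * R₁) / 2 +
              ν / M * ((σ * H₁ - H₂ - σ * R₂) / 2))) := by
          linear_combination (σ ^ l * pow ℓ ν z * H₂ * (1 - ν / M) / 2) * hp4
        rw [hL, hp3, hp2, e2]
        field_simp
        ring) n
  have hpow : ∀ k : ℕ, σ ^ (2 * k) = 1 := fun k => by rw [pow_mul, hσ, one_pow]
  -- Undoing the scaling at odd indices absorbs one σ; hence the sign exponents of the `coeffB`
  -- terms are one lower in the z^ν family.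
  have hodd : ∀ (a k : ℕ) (B X : ℂ), σ ^ (a + 1) * B * (σ ^ (2 * k + 1) * X) = σ ^ a * B * X := by
    intro a k B X
    rw [pow_succ, pow_succ, hpow]
    linear_combination σ ^ a * B * X * hσ
  simp only [evenFormula, oddFormula, Nat.cast_zero, add_zero, sub_zero, pow_zero, one_mul,
    Nat.cast_add, Nat.cast_mul, Nat.cast_ofNat, Nat.cast_one, ← add_assoc, ← sub_sub] at key₁ key₂
  refine ⟨fun hc => key₁.1 hc z hz, fun hc => key₁.2 hc z hz, fun hc => ?_, fun hc => ?_⟩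
  · rw [key₂.1 (fun i hi h0 => hc i hi (neg_injective h0)) z hz]
    simp only [hodd, hpow, one_mul]
  · rw [key₂.2 (fun i hi h0 => hc i hi (neg_injective h0)) z hz]
    simp only [hodd, hpow, one_mul]

end Relations
end DerivFormula
end

/-! ### Struve functions: power series and their recurrences. -/

noncomputable section
namespace DerivFormula
open Filter Topology

/-- The coefficient `1 / (Γ(k+3/2) Γ(k+μ+3/2))` of the Struve series. -/
def struveCoeff (μ : ℂ) (k : ℕ) : ℂ :=
  (Complex.Gamma (k + 3 / 2))⁻¹ * (Complex.Gamma (k + μ + 3 / 2))⁻¹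

/-- The `k`-th term of the Struve series, with sign `ε ^ k`. -/
def struveTerm (ε μ : ℂ) (k : ℕ) (z : ℂ) : ℂ := ε ^ k * (z / 2) ^ (2 * k) * struveCoeff μ k

/-- The power series in the definition of the Struve functions. -/
def struveSeries (ε μ z : ℂ) : ℂ := ∑' k : ℕ, struveTerm ε μ k z

/-- The common form of the Struve function (`ε = -1`) and the modified one (`ε = 1`). -/
def struveFun (ε : ℂ) (ℓ : ℂ → ℂ) (ν z : ℂ) : ℂ :=
  (1 / 2 : ℂ) ^ (ν + 1) * pow ℓ (ν + 1) z * struveSeries ε ν z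

/-- The inhomogeneous term `(z/2)^μ / (√π Γ(μ+3/2))` of the Struve recurrences. -/
def struveRest (ℓ : ℂ → ℂ) (μ z : ℂ) : ℂ :=
  (1 / 2 : ℂ) ^ μ * pow ℓ μ z * ((Real.sqrt Real.pi : ℂ)⁻¹ * (Complex.Gamma (μ + 3 / 2))⁻¹)

theorem struveH_eq (ℓ : ℂ → ℂ) : struveH ℓ = struveFun (-1) ℓ := rfl

theorem struveL_eq (ℓ : ℂ → ℂ) : struveL ℓ = struveFun 1 ℓ := by
  ext ν z
  simp [struveL, struveFun, struveSeries, struveTerm, struveCoeff]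

/-- Since 1/Γ is 0 at the poles, this needs no exclusion, and all Struve relations hold for every
order. -/
theorem inv_Gamma_eq (s : ℂ) : (Complex.Gamma s)⁻¹ = s * (Complex.Gamma (s + 1))⁻¹ :=
  Complex.one_div_Gamma_eq_self_mul_one_div_Gamma_add_one s

theorem struveCoeff_sub_one (μ : ℂ) (k : ℕ) :
    struveCoeff (μ - 1) k = (k + μ + 1 / 2) * struveCoeff μ k := by
  rw [struveCoeff, inv_Gamma_eq (k + (μ - 1) + 3 / 2), struveCoeff,
    show (k : ℂ) + (μ - 1) + 3 / 2 + 1 = k + μ + 3 / 2 by ring]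
  ring

theorem struveCoeff_add_one (μ : ℂ) (k : ℕ) :
    struveCoeff (μ + 1) k = (k + 3 / 2) * struveCoeff μ (k + 1) := by
  rw [struveCoeff, inv_Gamma_eq (k + 3 / 2), struveCoeff]
  push_cast
  rw [show (k : ℂ) + 1 + μ + 3 / 2 = k + (μ + 1) + 3 / 2 by ring,
    show (k : ℂ) + 1 + 3 / 2 = k + 3 / 2 + 1 by ring]
  ring

theorem struveCoeff_eq_mul_succ (μ : ℂ) (k : ℕ) :
    struveCoeff μ k = (k + 3 / 2) * (k + μ + 3 / 2) * struveCoeff μ (k + 1) := by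
  have h := struveCoeff_sub_one (μ + 1) k
  rw [add_sub_cancel_right, struveCoeff_add_one] at h
  rw [h]
  ring

theorem struveCoeff_zero (μ : ℂ) :
    struveCoeff μ 0 = 2 * ((Real.sqrt Real.pi : ℂ)⁻¹ * (Complex.Gamma (μ + 3 / 2))⁻¹) := by
  have h : Complex.Gamma (3 / 2) = (Real.sqrt Real.pi : ℂ) / 2 := by
    rw [show (3 / 2 : ℂ) = 1 / 2 + 1 by norm_num, Complex.Gamma_add_one _ (by norm_num),
      Complex.Gamma_one_half_eq, Real.sqrt_eq_rpow, Complex.ofReal_cpow Real.pi_pos.le]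
    push_cast
    ring
  rw [struveCoeff, Nat.cast_zero, zero_add, zero_add, h, inv_div]
  ring

theorem summable_norm_struveCoeff (μ : ℂ) {R : ℝ} (hR : 0 ≤ R) :
    Summable fun k : ℕ => ‖struveCoeff μ k‖ * R ^ k := by
  refine summable_of_ratio_norm_eventually_le (r := 1 / 2) (by norm_num) ?_
  -- Ratio test: consecutive terms have ratio R / (|k+3/2| |k+μ+3/2|). Past this threshold the
  -- second factor is at least 2R, while the first is at least 1.
  filter_upwards [eventually_ge_atTop ⌈2 * R + 1 + ‖μ + 3 / 2‖⌉₊] with k hk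
  have hk' : 2 * R + 1 + ‖μ + 3 / 2‖ ≤ k := (Nat.le_ceil _).trans (by exact_mod_cast hk)
  have h1 : 1 ≤ ‖(k : ℂ) + 3 / 2‖ := by
    have h : (k : ℂ) + 3 / 2 = ((k + 3 / 2 : ℝ) : ℂ) := by push_cast; ring
    rw [h, Complex.norm_real, Real.norm_of_nonneg (by positivity)]
    have : (0 : ℝ) ≤ k := Nat.cast_nonneg k
    linarith
  have h2 : 2 * R ≤ ‖(k : ℂ) + μ + 3 / 2‖ := by
    have h := norm_sub_norm_le (k : ℂ) (-(μ + 3 / 2))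
    rw [norm_neg, sub_neg_eq_add, Complex.norm_natCast, ← add_assoc] at h
    linarith
  have h3 : ‖struveCoeff μ k‖ =
      ‖(k : ℂ) + 3 / 2‖ * ‖(k : ℂ) + μ + 3 / 2‖ * ‖struveCoeff μ (k + 1)‖ := by
    rw [struveCoeff_eq_mul_succ, norm_mul, norm_mul]
  have h4 : 2 * R ≤ ‖(k : ℂ) + 3 / 2‖ * ‖(k : ℂ) + μ + 3 / 2‖ := by
    nlinarith [norm_nonneg ((k : ℂ) + μ + 3 / 2)]
  rw [Real.norm_of_nonneg (by positivity), Real.norm_of_nonneg (by positivity), h3, pow_succ]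
  have h5 := mul_le_mul_of_nonneg_right h4
    (mul_nonneg (norm_nonneg (struveCoeff μ (k + 1))) (pow_nonneg hR k))
  nlinarith

section Series

variable {ε : ℂ}

theorem hasSum_of_eq {f g : ℕ → ℂ} {a : ℂ} (h : ∀ k, f k = g k) (hg : HasSum g a) :
    HasSum f a := by
  rwa [funext h]

theorem norm_struveTerm_le (hε : ‖ε‖ = 1) (μ : ℂ) (k : ℕ) {z : ℂ} {R : ℝ} (hz : ‖z‖ ≤ R) :
    ‖struveTerm ε μ k z‖ ≤ ‖struveCoeff μ k‖ * (R ^ 2) ^ k := by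
  rw [struveTerm, norm_mul, norm_mul, norm_pow, norm_pow, hε, one_pow, one_mul, mul_comm, pow_mul,
    norm_div, Complex.norm_ofNat]
  have : ‖z‖ / 2 ≤ R := by linarith [norm_nonneg z]
  gcongr

theorem differentiable_struveTerm (μ : ℂ) (k : ℕ) : Differentiable ℂ (struveTerm ε μ k) := by
  unfold struveTerm
  fun_prop

/-- The Euler operator z d/dz acts diagonally on the terms, so the differential relation also
becomes a comparison of weights. -/
theorem mul_deriv_struveTerm (μ : ℂ) (k : ℕ) (z : ℂ) :
    z * deriv (struveTerm ε μ k) z = 2 * k * struveTerm ε μ k z := by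
  have h : HasDerivAt (struveTerm ε μ k) _ z :=
    ((((hasDerivAt_id z).div_const 2).fun_pow (2 * k)).const_mul (ε ^ k)).mul_const
      (struveCoeff μ k)
  rw [h.deriv, struveTerm]
  rcases k with _ | k
  · simp
  · rw [show 2 * (k + 1) - 1 = 2 * k + 1 by omega, show 2 * (k + 1) = 2 * k + 1 + 1 by ring,
      pow_succ (z / 2)]
    simp only [id]
    push_cast
    ring

theorem hasSum_struveTerm (hε : ‖ε‖ = 1) (μ z : ℂ) :
    HasSum (fun k => struveTerm ε μ k z) (struveSeries ε μ z) :=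
  (Summable.of_norm_bounded (summable_norm_struveCoeff μ (sq_nonneg ‖z‖))
    fun k => norm_struveTerm_le hε μ k le_rfl).hasSum

theorem differentiable_struveSeries (hε : ‖ε‖ = 1) (μ : ℂ) :
    Differentiable ℂ (struveSeries ε μ) := fun z =>
  (Complex.differentiableOn_tsum_of_summable_norm
    (summable_norm_struveCoeff μ (sq_nonneg (‖z‖ + 1)))
    (fun k => (differentiable_struveTerm μ k).differentiableOn) Metric.isOpen_ball
    (fun k _ hw => norm_struveTerm_le hε μ k (mem_ball_zero_iff.1 hw).le)).differentiableAt
    (Metric.isOpen_ball.mem_nhds (by simp : z ∈ Metric.ball (0 : ℂ) (‖z‖ + 1)))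

theorem hasSum_mul_struveTerm (hε : ‖ε‖ = 1) (μ z : ℂ) :
    HasSum (fun k : ℕ => 2 * k * struveTerm ε μ k z) (z * deriv (struveSeries ε μ) z) := by
  have h := (Complex.hasSum_deriv_of_summable_norm
    (summable_norm_struveCoeff μ (sq_nonneg (‖z‖ + 1)))
    (fun k => (differentiable_struveTerm μ k).differentiableOn) Metric.isOpen_ball
    (fun k _ hw => norm_struveTerm_le hε μ k (mem_ball_zero_iff.1 hw).le)
    (by simp : z ∈ Metric.ball (0 : ℂ) (‖z‖ + 1))).mul_left z
  simp only [mul_deriv_struveTerm] at h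
  exact h

theorem hasSum_struveTerm_sub_one (hε : ‖ε‖ = 1) (μ z : ℂ) :
    HasSum (fun k : ℕ => (k + μ + 1 / 2) * struveTerm ε μ k z) (struveSeries ε (μ - 1) z) := by
  refine hasSum_of_eq (fun k => ?_) (hasSum_struveTerm hε (μ - 1) z)
  rw [struveTerm, struveTerm, struveCoeff_sub_one]
  ring

/-- Multiplication by ε(z/2)² turns the k-th term of order μ+1 into (k+3/2) times the (k+1)-st term
of order μ. The missing term k = 0, of weight 1/2, is the inhomogeneous constant. -/
theorem hasSum_struveTerm_add_one (hε : ‖ε‖ = 1) (μ z : ℂ) :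
    HasSum (fun k : ℕ => (k + 1 / 2) * struveTerm ε μ k z)
      (ε * (z / 2) ^ 2 * struveSeries ε (μ + 1) z +
        (Real.sqrt Real.pi : ℂ)⁻¹ * (Complex.Gamma (μ + 3 / 2))⁻¹) := by
  have h := (hasSum_struveTerm hε (μ + 1) z).mul_left (ε * (z / 2) ^ 2)
  have h' : HasSum (fun k : ℕ => ((k + 1 : ℕ) + 1 / 2) * struveTerm ε μ (k + 1) z)
      (ε * (z / 2) ^ 2 * struveSeries ε (μ + 1) z) := by
    refine hasSum_of_eq (fun k => ?_) h
    rw [struveTerm, struveTerm, struveCoeff_add_one]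
    push_cast
    ring
  have h0 := (hasSum_nat_add_iff (f := fun k : ℕ => ((k : ℂ) + 1 / 2) * struveTerm ε μ k z) 1).1 h'
  have e : ∑ k ∈ Finset.range 1, ((k : ℂ) + 1 / 2) * struveTerm ε μ k z =
      (Real.sqrt Real.pi : ℂ)⁻¹ * (Complex.Gamma (μ + 3 / 2))⁻¹ := by
    simp [struveTerm, struveCoeff_zero]
  rwa [e] at h0

/-- The weights satisfy (k + μ + 1/2) - (k + 1/2) = μ. -/
theorem struveSeries_sub (hε : ‖ε‖ = 1) (μ z : ℂ) :
    struveSeries ε (μ - 1) z - (ε * (z / 2) ^ 2 * struveSeries ε (μ + 1) z +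
      (Real.sqrt Real.pi : ℂ)⁻¹ * (Complex.Gamma (μ + 3 / 2))⁻¹) = μ * struveSeries ε μ z := by
  have h := (hasSum_struveTerm_sub_one hε μ z).sub (hasSum_struveTerm_add_one hε μ z)
  refine h.unique ?_
  refine hasSum_of_eq (fun k => ?_) ((hasSum_struveTerm hε μ z).mul_left μ)
  ring

/-- The weights add up to (μ + 1) + 2k, and 2k is the Euler operator. -/
theorem struveSeries_add (hε : ‖ε‖ = 1) (μ z : ℂ) :
    struveSeries ε (μ - 1) z + (ε * (z / 2) ^ 2 * struveSeries ε (μ + 1) z +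
      (Real.sqrt Real.pi : ℂ)⁻¹ * (Complex.Gamma (μ + 3 / 2))⁻¹) =
      (μ + 1) * struveSeries ε μ z + z * deriv (struveSeries ε μ) z := by
  have h := (hasSum_struveTerm_sub_one hε μ z).add (hasSum_struveTerm_add_one hε μ z)
  refine h.unique ?_
  refine hasSum_of_eq (fun k => ?_)
    (((hasSum_struveTerm hε μ z).mul_left (μ + 1)).add (hasSum_mul_struveTerm hε μ z))
  ring

end Series

section Relations

variable {U : Set ℂ} {ℓ : ℂ → ℂ} {ε z : ℂ}

theorem half_cpow_add (a b : ℂ) : (1 / 2 : ℂ) ^ (a + b) = (1 / 2) ^ a * (1 / 2) ^ b :=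
  Complex.cpow_add _ _ (by norm_num)

theorem half_cpow_add_one (a : ℂ) : (1 / 2 : ℂ) ^ (a + 1) = (1 / 2) ^ a / 2 := by
  rw [half_cpow_add, Complex.cpow_one]
  ring

theorem struveFun_eq (hz : Complex.exp (ℓ z) = z) (μ : ℂ) :
    struveFun ε ℓ μ z = (1 / 2 : ℂ) ^ μ * pow ℓ μ z * (z / 2 * struveSeries ε μ z) := by
  rw [struveFun, half_cpow_add_one, pow_add, pow_one' hz]
  ring

theorem struveFun_sub_one (μ : ℂ) :
    struveFun ε ℓ (μ - 1) z = (1 / 2 : ℂ) ^ μ * pow ℓ μ z * struveSeries ε (μ - 1) z := by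
  rw [struveFun, sub_add_cancel]

theorem struveFun_add_one (hz : Complex.exp (ℓ z) = z) (μ : ℂ) :
    struveFun ε ℓ (μ + 1) z =
      (1 / 2 : ℂ) ^ μ * pow ℓ μ z * ((z / 2) ^ 2 * struveSeries ε (μ + 1) z) := by
  rw [struveFun_eq hz, half_cpow_add_one, pow_add, pow_one' hz]
  ring

theorem hasDerivAt_struveFun (hℓ : HasDerivAt ℓ z⁻¹ z) (hz : Complex.exp (ℓ z) = z)
    (hε : ‖ε‖ = 1) (μ : ℂ) :
    HasDerivAt (struveFun ε ℓ μ) ((struveFun ε ℓ (μ - 1) z + ε * struveFun ε ℓ (μ + 1) z +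
      struveRest ℓ μ z) / 2) z := by
  have h : HasDerivAt (struveFun ε ℓ μ) _ z := ((hasDerivAt_pow hℓ hz (μ + 1)).const_mul
    ((1 / 2 : ℂ) ^ (μ + 1))).fun_mul (differentiable_struveSeries hε μ z).hasDerivAt
  refine h.congr_deriv ?_
  rw [struveFun_sub_one, struveFun_add_one hz, struveRest, half_cpow_add_one, add_sub_cancel_right,
    pow_add, pow_one' hz]
  linear_combination (-(1 / 2 : ℂ) ^ μ * pow ℓ μ z / 2) * struveSeries_add hε μ z

theorem struveFun_recurrence (hz : Complex.exp (ℓ z) = z) (hε : ‖ε‖ = 1) (μ : ℂ) :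
    2 * (μ / z * struveFun ε ℓ μ z) =
      struveFun ε ℓ (μ - 1) z - ε * struveFun ε ℓ (μ + 1) z - struveRest ℓ μ z := by
  rw [struveFun_sub_one, struveFun_add_one hz, struveRest, struveFun_eq hz]
  have hz0 := ne_zero_of_branch hz
  have h : 2 * (μ / z * ((1 / 2 : ℂ) ^ μ * pow ℓ μ z * (z / 2 * struveSeries ε μ z))) =
      (1 / 2 : ℂ) ^ μ * pow ℓ μ z * (μ * struveSeries ε μ z) := by
    field_simp
  rw [h]
  linear_combination (-(1 / 2 : ℂ) ^ μ * pow ℓ μ z) * struveSeries_sub hε μ z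

theorem hasDerivAt_tTerm (ν : ℂ) (l m : ℕ) (hz : z ≠ 0) :
    HasDerivAt (tTerm ν l m) (tTerm ν l (m + 1) z) z := by
  unfold tTerm
  by_cases hl : l = 0
  · simp only [if_pos hl, Nat.succ_ne_zero, if_false, mul_zero]
    exact hasDerivAt_const z _
  · simp only [if_neg hl]
    refine ((hasDerivAt_zpow ((l : ℤ) - m) z (Or.inl hz)).const_mul _).congr_deriv ?_
    rw [falling_succ, show (l : ℤ) - (m + 1 : ℕ) = l - m - 1 by push_cast; ring]
    push_cast
    ring

theorem hasDerivAt_uTerm (hℓ : HasDerivAt ℓ z⁻¹ z) (hz : Complex.exp (ℓ z) = z) (ν : ℂ)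
    (l m : ℕ) : HasDerivAt (uTerm ℓ ν l m) (uTerm ℓ ν l (m + 1) z) z := by
  unfold uTerm
  split_ifs with hl
  · exact hasDerivAt_const z _
  · simp only [mul_assoc _ (falling _ _)]
    exact (hasDerivAt_falling_mul_pow hℓ hz (2 * ν - l) m).const_mul _

theorem formulas_struve (hU : IsOpen U) (hℓ : ∀ z ∈ U, HasDerivAt ℓ z⁻¹ z)
    (hexp : ∀ z ∈ U, Complex.exp (ℓ z) = z) (hε : ε ^ 2 = 1) :
    Formulas ε U ℓ (struveFun ε ℓ) tTerm (uTerm ℓ) := by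
  have hε' : ‖ε‖ = 1 := by
    have h := congrArg norm hε
    rw [norm_pow, norm_one] at h
    exact (pow_eq_one_iff_of_nonneg (norm_nonneg _) two_ne_zero).1 h
  have hsqrt : (Real.sqrt Real.pi : ℂ) ≠ 0 := by
    exact_mod_cast (Real.sqrt_pos.2 Real.pi_pos).ne'
  refine formulas_of_relations (r₁ := struveRest ℓ) (r₂ := struveRest ℓ) hU hℓ hexp hε
    (fun μ z hz => hasDerivAt_struveFun (hℓ z hz) (hexp z hz) hε' μ)
    (fun μ z hz => struveFun_recurrence (hexp z hz) hε' μ)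
    (fun ν l m z hz => hasDerivAt_tTerm ν l m (ne_zero_of_branch (hexp z hz)))
    (fun ν l m z hz => hasDerivAt_uTerm (hℓ z hz) (hexp z hz) ν l m) ?_ ?_ ?_ ?_
  · intro ν z hz
    have hp : pow ℓ ν z ≠ 0 := pow_ne_zero' ν z
    rw [tTerm, if_pos rfl, if_pos rfl, struveRest]
    field_simp
    norm_num
  · intro ν l hl hνl z hz
    have hp : pow ℓ ν z ≠ 0 := pow_ne_zero' ν z
    rw [tTerm, if_neg hl, struveRest, falling_zero, half_cpow_add_one, pow_add,
      pow_natCast (hexp z hz), Nat.cast_zero, sub_zero, zpow_natCast]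
    field_simp
    ring
  · intro ν z hz
    simp [uTerm]
  · intro ν l hl hνl z hz
    have hνl' : (l : ℂ) - ν ≠ 0 := fun h => hνl (by linear_combination -h)
    rw [uTerm, if_neg hl, struveRest, falling_zero, half_cpow_add_one, Nat.cast_zero, sub_zero,
      show 2 * ν - (l : ℂ) = ν + (ν - l) by ring, pow_add]
    -- As r₁ = r₂, the two rests combine with this weight; it produces the factor l of `uTerm`.
    have h : 1 - ν / (ν - l) = l / ((l : ℂ) - ν) := by
      rw [← neg_sub (l : ℂ) ν] at hνl ⊢
      field_simp
      ring
    rw [show ∀ x, x - ν / (ν - l) * x = (1 - ν / (ν - l)) * x by intro x; ring, h]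
    field_simp

end Relations
end DerivFormula
end

/-! ### Anger and Weber functions: integral representations and their recurrences. -/

noncomputable section
namespace DerivFormula
open intervalIntegral

/-- The common form of the Anger function (`α = 0`) and the Weber function (`α = π / 2`). -/
def angerWeber (α ν z : ℂ) : ℂ :=
  1 / (Real.pi : ℂ) * ∫ θ in (0 : ℝ)..Real.pi, Complex.cos (ν * θ - z * Real.sin θ - α)

/-- The boundary term of the Anger-Weber recurrence. -/
def angerWeberC (α x : ℂ) : ℂ := Complex.sin (Real.pi * x - α) + Complex.sin α

theorem angerJ_eq : angerJ = angerWeber 0 := by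
  ext ν z
  simp [angerJ, angerWeber]

theorem weberE_eq : weberE = angerWeber (Real.pi / 2) := by
  ext ν z
  simp [weberE, angerWeber, Complex.cos_sub_pi_div_two]

theorem angerC_eq : angerC = angerWeberC 0 := by
  ext x
  simp [angerC, angerWeberC]

theorem weberC_eq : weberC = angerWeberC (Real.pi / 2) := by
  ext x
  simp [weberC, angerWeberC, Complex.sin_sub_pi_div_two]
  ring

theorem hasDerivAt_angerWeber_integral (α ν z : ℂ) :
    HasDerivAt (angerWeber α ν) (1 / (Real.pi : ℂ) * ∫ θ in (0 : ℝ)..Real.pi,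
      Complex.sin (ν * θ - z * Real.sin θ - α) * Real.sin θ) z := by
  have hcont : Continuous fun p : ℂ × ℝ =>
      ‖Complex.sin (ν * p.2 - p.1 * Real.sin p.2 - α) * Real.sin p.2‖ := by fun_prop
  -- By compactness a constant dominates the z-derivative of the integrand for all parameters near
  -- `z`.
  obtain ⟨C, hC⟩ := ((isCompact_closedBall z 1).prod
    (isCompact_Icc (a := (0 : ℝ)) (b := Real.pi))).exists_bound_of_continuousOn hcont.continuousOn
  refine (intervalIntegral.hasDerivAt_integral_of_dominated_loc_of_deriv_le
    (F := fun s (θ : ℝ) => Complex.cos (ν * θ - s * Real.sin θ - α))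
    (F' := fun s (θ : ℝ) => Complex.sin (ν * θ - s * Real.sin θ - α) * Real.sin θ)
    (bound := fun _ => C)
    (Metric.ball_mem_nhds z one_pos) ?_ ?_ ?_ ?_ ?_ ?_).2.const_mul _
  · exact Filter.Eventually.of_forall fun s => (by fun_prop : Continuous _).aestronglyMeasurable
  · exact (by fun_prop : Continuous _).intervalIntegrable _ _
  · exact (by fun_prop : Continuous _).aestronglyMeasurable
  · refine Filter.Eventually.of_forall fun θ hθ s hs => ?_
    rw [Set.uIoc_of_le Real.pi_pos.le] at hθ
    simpa using hC (s, θ) ⟨Metric.ball_subset_closedBall hs, Set.Ioc_subset_Icc_self hθ⟩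
  · exact intervalIntegrable_const
  · refine Filter.Eventually.of_forall fun θ _ s _ => ?_
    have h := ((((hasDerivAt_id s).mul_const (Real.sin θ : ℂ)).const_sub (ν * θ)).sub_const α).ccos
    refine h.congr_deriv ?_
    simp

/-- Changing ν by one shifts the phase by θ, and the addition theorem splits the cosine. The sum and
difference of the two neighbours then isolate one integral each. -/
theorem angerWeber_sub_one (α ν z : ℂ) :
    angerWeber α (ν - 1) z = 1 / (Real.pi : ℂ) * ((∫ θ in (0 : ℝ)..Real.pi,
        Complex.cos (ν * θ - z * Real.sin θ - α) * Real.cos θ) +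
      ∫ θ in (0 : ℝ)..Real.pi, Complex.sin (ν * θ - z * Real.sin θ - α) * Real.sin θ) := by
  rw [angerWeber, ← integral_add ((by fun_prop : Continuous _).intervalIntegrable _ _)
    ((by fun_prop : Continuous _).intervalIntegrable _ _)]
  congr 1
  refine integral_congr fun θ _ => ?_
  rw [show (ν - 1) * θ - z * Real.sin θ - α = (ν * θ - z * Real.sin θ - α) - θ by ring,
    Complex.cos_sub, Complex.ofReal_cos, Complex.ofReal_sin]

theorem angerWeber_add_one (α ν z : ℂ) :
    angerWeber α (ν + 1) z = 1 / (Real.pi : ℂ) * ((∫ θ in (0 : ℝ)..Real.pi,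
        Complex.cos (ν * θ - z * Real.sin θ - α) * Real.cos θ) -
      ∫ θ in (0 : ℝ)..Real.pi, Complex.sin (ν * θ - z * Real.sin θ - α) * Real.sin θ) := by
  rw [angerWeber, ← integral_sub ((by fun_prop : Continuous _).intervalIntegrable _ _)
    ((by fun_prop : Continuous _).intervalIntegrable _ _)]
  congr 1
  refine integral_congr fun θ _ => ?_
  rw [show (ν + 1) * θ - z * Real.sin θ - α = (ν * θ - z * Real.sin θ - α) + θ by ring,
    Complex.cos_add, Complex.ofReal_cos, Complex.ofReal_sin]

theorem hasDerivAt_angerWeber (α ν z : ℂ) :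
    HasDerivAt (angerWeber α ν)
      ((angerWeber α (ν - 1) z + -1 * angerWeber α (ν + 1) z + 0) / 2) z := by
  refine (hasDerivAt_angerWeber_integral α ν z).congr_deriv ?_
  rw [angerWeber_sub_one, angerWeber_add_one]
  ring

/-- The combined integrand is the θ-derivative of sin(νθ - z sin θ - α). As sin θ vanishes at 0 and
π, the boundary value does not depend on z. -/
theorem integral_angerWeber_boundary (α ν z : ℂ) :
    ν * (∫ θ in (0 : ℝ)..Real.pi, Complex.cos (ν * θ - z * Real.sin θ - α)) -
      z * (∫ θ in (0 : ℝ)..Real.pi, Complex.cos (ν * θ - z * Real.sin θ - α) * Real.cos θ) =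
      angerWeberC α ν := by
  have h : ∀ θ ∈ Set.uIcc 0 Real.pi,
      HasDerivAt (fun θ : ℝ => Complex.sin (ν * θ - z * Real.sin θ - α))
        (ν * Complex.cos (ν * θ - z * Real.sin θ - α) -
          z * (Complex.cos (ν * θ - z * Real.sin θ - α) * Real.cos θ)) θ := fun θ _ => by
    have h := ((((hasDerivAt_id θ).ofReal_comp.const_mul ν).fun_sub
      ((Real.hasDerivAt_sin θ).ofReal_comp.const_mul z)).sub_const α)
    refine ((Complex.hasDerivAt_sin _).comp θ h).congr_deriv ?_
    simp
    ring
  have h' := integral_eq_sub_of_hasDerivAt h ((by fun_prop : Continuous _).intervalIntegrable _ _)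
  rw [integral_sub ((by fun_prop : Continuous _).intervalIntegrable _ _)
    ((by fun_prop : Continuous _).intervalIntegrable _ _), integral_const_mul,
    integral_const_mul] at h'
  rw [h', angerWeberC]
  simp [mul_comm ν]

theorem angerWeber_recurrence (α ν : ℂ) {z : ℂ} (hz : z ≠ 0) :
    2 * (ν / z * angerWeber α ν z) = angerWeber α (ν - 1) z - -1 * angerWeber α (ν + 1) z -
      -(2 * angerWeberC α ν / (Real.pi * z)) := by
  have hpi : (Real.pi : ℂ) ≠ 0 := by exact_mod_cast Real.pi_ne_zero
  rw [angerWeber_sub_one, angerWeber_add_one, ← integral_angerWeber_boundary α ν z, angerWeber]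
  field_simp
  ring

variable {U : Set ℂ} {ℓ : ℂ → ℂ} {z : ℂ}

theorem hasDerivAt_vTerm (c : ℂ → ℂ) (hℓ : HasDerivAt ℓ z⁻¹ z) (hz : Complex.exp (ℓ z) = z)
    (ν : ℂ) (l m : ℕ) : HasDerivAt (vTerm c ℓ ν l m) (vTerm c ℓ ν l (m + 1) z) z := by
  have e : ∀ m : ℕ, -ν - (m : ℂ) - 1 = -ν - 1 - m := fun m => by ring
  unfold vTerm
  simp only [e]
  split_ifs with hl <;>
  · simp only [mul_assoc _ (falling _ _)]
    exact (hasDerivAt_falling_mul_pow hℓ hz _ m).const_mul _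

theorem hasDerivAt_wTerm (c : ℂ → ℂ) (hℓ : HasDerivAt ℓ z⁻¹ z) (hz : Complex.exp (ℓ z) = z)
    (ν : ℂ) (l m : ℕ) : HasDerivAt (wTerm c ℓ ν l m) (wTerm c ℓ ν l (m + 1) z) z := by
  have e : ∀ m : ℕ, ν - (m : ℂ) - 1 = ν - 1 - m := fun m => by ring
  unfold wTerm
  simp only [e]
  split_ifs with hl <;>
  · simp only [mul_assoc _ (falling _ _)]
    exact (hasDerivAt_falling_mul_pow hℓ hz _ m).const_mul _

theorem formulas_angerWeber (hU : IsOpen U) (hℓ : ∀ z ∈ U, HasDerivAt ℓ z⁻¹ z)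
    (hexp : ∀ z ∈ U, Complex.exp (ℓ z) = z) (α : ℂ) :
    Formulas (-1) U ℓ (angerWeber α) (vTerm (angerWeberC α) ℓ) (wTerm (angerWeberC α) ℓ) := by
  have hpi : (Real.pi : ℂ) ≠ 0 := by exact_mod_cast Real.pi_ne_zero
  refine formulas_of_relations (r₁ := fun _ _ => 0)
    (r₂ := fun μ z => -(2 * angerWeberC α μ / (Real.pi * z))) hU hℓ hexp (by norm_num)
    (fun μ z _ => hasDerivAt_angerWeber α μ z)
    (fun μ z hz => angerWeber_recurrence α μ (ne_zero_of_branch (hexp z hz)))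
    (fun ν l m z hz => hasDerivAt_vTerm _ (hℓ z hz) (hexp z hz) ν l m)
    (fun ν l m z hz => hasDerivAt_wTerm _ (hℓ z hz) (hexp z hz) ν l m) ?_ ?_ ?_ ?_
  · intro ν z hz
    have hz0 := ne_zero_of_branch (hexp z hz)
    have hp : pow ℓ ν z ≠ 0 := pow_ne_zero' ν z
    rw [vTerm, if_pos rfl, falling_zero, Nat.cast_zero, sub_zero, pow_sub_one (hexp z hz), pow_neg]
    field_simp
    ring
  · intro ν l hl hνl z hz
    have hz0 := ne_zero_of_branch (hexp z hz)
    have hp : pow ℓ ν z ≠ 0 := pow_ne_zero' ν z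
    rw [vTerm, if_neg hl, falling_zero, Nat.cast_zero, sub_zero, pow_sub_one (hexp z hz), pow_neg]
    field_simp
    ring
  · intro ν z hz
    have hz0 := ne_zero_of_branch (hexp z hz)
    rw [wTerm, if_pos rfl, falling_zero, Nat.cast_zero, sub_zero, pow_sub_one (hexp z hz)]
    field_simp
    ring
  · intro ν l hl hνl z hz
    have hz0 := ne_zero_of_branch (hexp z hz)
    rw [wTerm, if_neg hl, falling_zero, Nat.cast_zero, sub_zero, pow_sub_one (hexp z hz)]
    field_simp
    ring

end DerivFormula
end

/-! ### The four function families together. -/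

theorem corollary3p3 (U : Set ℂ) (hU : IsOpen U) (ℓ : ℂ → ℂ) (hcont : ContinuousOn ℓ U)
    (hexp : ∀ z ∈ U, Complex.exp (ℓ z) = z) :
    DerivFormula.FormulasG U ℓ (DerivFormula.struveH ℓ)
        DerivFormula.tTerm (DerivFormula.uTerm ℓ) ∧
      DerivFormula.FormulasF U ℓ (DerivFormula.struveL ℓ)
        DerivFormula.tTerm (DerivFormula.uTerm ℓ) ∧
      DerivFormula.FormulasG U ℓ DerivFormula.angerJ
        (DerivFormula.vTerm DerivFormula.angerC ℓ) (DerivFormula.wTerm DerivFormula.angerC ℓ) ∧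
      DerivFormula.FormulasG U ℓ DerivFormula.weberE
        (DerivFormula.vTerm DerivFormula.weberC ℓ)
        (DerivFormula.wTerm DerivFormula.weberC ℓ) := by
  have hℓ : ∀ z ∈ U, HasDerivAt ℓ z⁻¹ z := fun z hz =>
    DerivFormula.hasDerivAt_branch hU hcont hexp hz
  rw [DerivFormula.struveH_eq, DerivFormula.struveL_eq, DerivFormula.angerJ_eq,
    DerivFormula.weberE_eq, DerivFormula.angerC_eq, DerivFormula.weberC_eq]
  exact ⟨(DerivFormula.formulas_struve hU hℓ hexp (by norm_num)).formulasG,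
    (DerivFormula.formulas_struve hU hℓ hexp (by norm_num)).formulasF,
    (DerivFormula.formulas_angerWeber hU hℓ hexp _).formulasG,
    (DerivFormula.formulas_angerWeber hU hℓ hexp _).formulasG⟩
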